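/- **Theorem (moment formula for the $G$-free product).** Let $G=(V,E)$ be a digraph without loops, i.e. $E\subseteq V\times V$ does not meet the diagonal (no finiteness is assumed); write $v\rightsquigarrow w$ for $(v,w)\in E$. For each $v\in V$ let $\mathcal H_v$ be a complex Hilbert space with a unit vector $\xi_v$ (inner products are linear in the second variable), let $\mathcal H_v^\circ=(\mathbb C\xi_v)^\perp$, and let $\phi_v(a)=\langle\xi_v,a\xi_v\rangle$ for $a\in B(\mathcal H_v)$. *The $G$-free product.* A reverse path is a sequence $(v_0,\dots,v_m)$, $m\ge 0$, with $v_{i+1}\rightsquigarrow v_i$ for $0\le i<m$. Let $(\mathcal H,\xi)$ be the pointed Hilbert space $$\mathcal H=\mathbb C\xi\oplus\bigoplus_{(v_0,\dots,v_m)\text{ reverse path}}\mathcal H_{v_0}^\circ\otimes\dots\otimes\mathcal H_{v_m}^\circ ,\qquad \|\xi\|=1$$ (Hilbert space direct sum and tensor products). For $v\in V$ let $\mathcal H_{\rightsquigarrow v}\subseteq\mathcal H$ be the sum of $\mathbb C\xi$ and of the summands of reverse paths with $v_0\rightsquigarrow v$, and let $\mathcal H_{\perp v}$ be the sum of the summands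 of reverse paths with $v_0\ne v$ and $v_0\not\rightsquigarrow v$. Writing $\mathcal H_v=\mathbb C\xi_v\oplus\mathcal H_v^\circ$ and identifying $\xi_v\otimes t$ with $t$ for $t\in\mathcal H_{\rightsquigarrow v}$, and $\mathcal H_v^\circ\otimes\mathcal H_{\rightsquigarrow v}$ with the sum of the summands of the reverse paths that start with $v$, one has $\mathcal H=(\mathcal H_v\otimes\mathcal H_{\rightsquigarrow v})\oplus\mathcal H_{\perp v}$. Define the $*$-homomorphism $\iota_v:B(\mathcal H_v)\to B(\mathcal H)$ by $\iota_v(a)=(a\otimes\mathrm{id}_{\mathcal H_{\rightsquigarrow v}})\oplus 0_{\mathcal H_{\perp v}}$. *Partitions.* A partition $\pi$ of $[k]=\{1,\dots,k\}$ is non-crossing if there are no $i<i'<j<j'$ with $i,j$ in a block $B$ and $i',j'$ in a block $B'\ne B$. For blocks $B,B'$ write $B\prec B'$ if there are $i<j$ in $B$ with $B'\subseteq\{i+1,\dots,j-1\}\subseteq[k]\setminus B$. The nesting forest $\mathrm F(\pi)$ is the digraph on the blocks of $\pi$ with an edge from $B$ to $B'$ if $B\prec B'$ and there is no block $B''$ with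 $B\prec B''\prec B'$. For $\ell:[k]\to V$, let $\mathcal{NC}_k(\ell,G)$ be the set of non-crossing partitions $\pi$ of $[k]$ such that $\ell$ is constant on each block $B$, with value denoted $\ell(B)$, and such that $B\mapsto\ell(B)$ is a digraph homomorphism $\mathrm F(\pi)\to G$, i.e. maps edges to edges. *Boolean cumulants.* For a unital algebra $\mathcal A$ and a functional $\phi$ on $\mathcal A$, and $n\ge 1$, let $$K_{\mathrm{bool},n}[a_1,\dots,a_n]=\sum_{\sigma}(-1)^{|\sigma|-1}\prod_{B\in\sigma}\phi\Big(\prod_{j\in B}a_j\Big),$$ where $\sigma$ runs over the partitions of $[n]$ all of whose blocks are intervals, and $\prod_{j\in B}a_j$ is taken in increasing order of $j$ from left to right. *Claim.* For every $k\in\mathbb N$, every $\ell:[k]\to V$, and all $a_j\in B(\mathcal H_{\ell(j)})$, $j=1,\dots,k$, $$\langle\xi,\iota_{\ell(1)}(a_1)\cdots\iota_{\ell(k)}(a_k)\xi\rangle=\sum_{\pi\in\mathcal{NC}_k(\ell,G)}\ \prod_{B\in\pi}K_{\mathrm{bool},|B|}[a_j:j\in B],$$ where for each block $B$ the cumulant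 is the one of $(B(\mathcal H_{\ell(B)}),\phi_{\ell(B)})$ and its arguments $a_j$, $j\in B$, are written in increasing order of their indices from left to right. -/

import Mathlib

open scoped TensorProduct InnerProductSpace ComplexConjugate

namespace GFree

universe u

noncomputable section

/-! ### Non-crossing partitions, nesting forest, compatibility -/

/-- Partitions of a set of `k` points, indexed by `Fin k`. -/
abbrev Partition (k : ℕ) : Type := Finpartition (Finset.univ : Finset (Fin k))

/-- A partition is non-crossing if there are no `i < i' < j < j'` with `i, j` in a block `B`
and `i', j'` in a different block `B'`. -/
def Partition.IsNonCrossing {k : ℕ} (π : Partition k) : Prop :=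
  ∀ B ∈ π.parts, ∀ B' ∈ π.parts, ∀ i ∈ B, ∀ i' ∈ B', ∀ j ∈ B, ∀ j' ∈ B',
    i < i' → i' < j → j < j' → B = B'

/-- `Nested B B'` (written `B ≺ B'`): the block `B'` is nested inside the block `B`, i.e. `B'` lies
strictly between two elements `i < j` of `B` that have no element of `B` between them. -/
def Nested {k : ℕ} (B B' : Finset (Fin k)) : Prop :=
  ∃ i ∈ B, ∃ j ∈ B, i < j ∧ B' ⊆ Finset.Ioo i j ∧ Disjoint (Finset.Ioo i j) B

/-- The nesting forest `F(π)`: the vertices are the blocks of `π`, and the edges `B ⇝ B'` are the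
covering relation of `≺`. -/
def Partition.nestingForest {k : ℕ} (π : Partition k) : Digraph π.parts where
  Adj B B' := Nested B.1 B'.1 ∧ ¬ ∃ B'' : π.parts, Nested B.1 B''.1 ∧ Nested B''.1 B'.1

/-- The labelling `ℓ` is constant on each block of `π`. -/
def Partition.IsConstantOnBlocks {V : Type*} {k : ℕ} (π : Partition k) (ℓ : Fin k → V) : Prop :=
  ∀ B ∈ π.parts, ∀ i ∈ B, ∀ j ∈ B, ℓ i = ℓ j

/-- The label of a block: the value of `ℓ` at its least element. If `ℓ` is constant on the blocks,
this is the common value of `ℓ` on the block. -/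
def Partition.blockLabel {V : Type*} {k : ℕ} (π : Partition k) (ℓ : Fin k → V) (B : π.parts) : V :=
  ℓ (B.1.min' (π.nonempty_of_mem_parts B.2))

/-- `π ∈ NC_k(ℓ, G)`: the partition `π` is non-crossing, `ℓ` is constant on its blocks, and the
induced map from blocks to vertices is a digraph homomorphism `F(π) → G`. -/
structure Partition.IsCompatible {V : Type*} {k : ℕ} (π : Partition k) (ℓ : Fin k → V)
    (G : Digraph V) : Prop where
  isNonCrossing : π.IsNonCrossing
  isConstantOnBlocks : π.IsConstantOnBlocks ℓ
  isHom : ∀ B B' : π.parts, π.nestingForest.Adj B B' →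
    G.Adj (π.blockLabel ℓ B) (π.blockLabel ℓ B')

theorem Partition.IsConstantOnBlocks.eq_blockLabel {V : Type*} {k : ℕ} {π : Partition k}
    {ℓ : Fin k → V} (h : π.IsConstantOnBlocks ℓ) (B : π.parts) {j : Fin k} (hj : j ∈ B.1) :
    ℓ j = π.blockLabel ℓ B :=
  h B.1 B.2 j hj _ (Finset.min'_mem _ _)

/-- The set `NC_k(ℓ, G)`. -/
abbrev NC {V : Type*} {k : ℕ} (ℓ : Fin k → V) (G : Digraph V) : Type :=
  {π : Partition k // π.IsCompatible ℓ G}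

instance {V : Type*} {k : ℕ} (ℓ : Fin k → V) (G : Digraph V) : Fintype (NC ℓ G) := by
  classical exact Subtype.fintype _

/-! ### Boolean cumulants -/

/-- A partition is an interval partition if each block is of the form `{i, …, j}` with `i ≤ j`. -/
def Partition.IsInterval {k : ℕ} (π : Partition k) : Prop :=
  ∀ B ∈ π.parts, ∃ i j : Fin k, i ≤ j ∧ B = Finset.Icc i j

open Classical in
/-- The `k`-th boolean cumulant
`K_k[a_1, …, a_k] = ∑_{π interval partition} (-1)^{|π| - 1} ∏_{B ∈ π} φ(∏_{j ∈ B} a_j)`,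
where the product over `j ∈ B` is taken in increasing order from left to right. It is meant for
`k ≥ 1`, so that `|π| ≥ 1` in each term. -/
def booleanCumulant {A : Type*} [Monoid A] (φ : A → ℂ) {k : ℕ} (a : Fin k → A) : ℂ :=
  ∑ π : Partition k with π.IsInterval,
    (-1) ^ (π.parts.card - 1) * ∏ B ∈ π.parts, φ (((B.sort (· ≤ ·)).map a).prod)

/-- The vector functional `a ↦ ⟨ξ, a ξ⟩` on `B(H)`. -/
def vectorState {H : Type*} [NormedAddCommGroup H] [InnerProductSpace ℂ H] (ξ : H) :
    (H →L[ℂ] H) → ℂ :=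
  fun a => ⟪ξ, a ξ⟫_ℂ

/-! ### Hilbert space tools -/

/-- The Hilbert space tensor product: the completion of the algebraic tensor product with respect to
the inner product `⟨x ⊗ y, x' ⊗ y'⟩ = ⟨x, x'⟩ ⟨y, y'⟩`. -/
abbrev HilbertTensor (E F : Type*) [NormedAddCommGroup E] [InnerProductSpace ℂ E]
    [NormedAddCommGroup F] [InnerProductSpace ℂ F] : Type _ :=
  UniformSpace.Completion (E ⊗[ℂ] F)

/-- The operator `a ⊗ id` between Hilbert space tensor products. -/
def tensorId {E E' : Type*} [NormedAddCommGroup E] [InnerProductSpace ℂ E]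
    [NormedAddCommGroup E'] [InnerProductSpace ℂ E'] (F : Type*) [NormedAddCommGroup F]
    [InnerProductSpace ℂ F] (a : E →L[ℂ] E') : HilbertTensor E F →L[ℂ] HilbertTensor E' F :=
  (a.rTensor F).completion

section Tensor

variable {E F K : Type*} [NormedAddCommGroup E] [InnerProductSpace ℂ E] [NormedAddCommGroup F]
  [InnerProductSpace ℂ F] [NormedAddCommGroup K] [InnerProductSpace ℂ K]

/-- The map `y ↦ x ⊗ y` between completions. -/
def tensorLeft (F : Type*) [NormedAddCommGroup F] [InnerProductSpace ℂ F] (x : E) :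
    UniformSpace.Completion F →L[ℂ] HilbertTensor E F :=
  (TensorProduct.mkL ℂ E F x).completion

theorem tensorLeft_coe (x : E) (y : F) :
    tensorLeft F x (y : UniformSpace.Completion F) = ((x ⊗ₜ[ℂ] y : E ⊗[ℂ] F) : HilbertTensor E F) :=
  ContinuousLinearMap.completion_apply_coe _ _

theorem inner_tensorLeft (x x' : E) (y y' : UniformSpace.Completion F) :
    ⟪tensorLeft F x y, tensorLeft F x' y'⟫_ℂ = ⟪x, x'⟫_ℂ * ⟪y, y'⟫_ℂ := by
  induction y, y' using UniformSpace.Completion.induction_on₂ with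
  | hp => exact isClosed_eq (by fun_prop) (by fun_prop)
  | ih y y' => simp [tensorLeft_coe]

theorem norm_tensorLeft (x : E) (y : UniformSpace.Completion F) :
    ‖tensorLeft F x y‖ = ‖x‖ * ‖y‖ := by
  have h := inner_tensorLeft x x y y
  rw [inner_self_eq_norm_sq_to_K, inner_self_eq_norm_sq_to_K, inner_self_eq_norm_sq_to_K,
    ← mul_pow] at h
  norm_cast at h
  exact (sq_eq_sq₀ (norm_nonneg _) (by positivity)).1 h

theorem tensorLeft_add (x x' : E) (y : UniformSpace.Completion F) :
    tensorLeft F (x + x') y = tensorLeft F x y + tensorLeft F x' y := by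
  induction y using UniformSpace.Completion.induction_on with
  | hp => exact isClosed_eq (by fun_prop) (by fun_prop)
  | ih y => simp [tensorLeft_coe, TensorProduct.add_tmul, UniformSpace.Completion.coe_add]

theorem tensorLeft_smul (c : ℂ) (x : E) (y : UniformSpace.Completion F) :
    tensorLeft F (c • x) y = c • tensorLeft F x y := by
  induction y using UniformSpace.Completion.induction_on with
  | hp =>
    exact isClosed_eq (tensorLeft F (c • x)).continuous ((tensorLeft F x).continuous.const_smul c)
  | ih y => simp [tensorLeft_coe, ← TensorProduct.smul_tmul', UniformSpace.Completion.coe_smul]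

/-- The linear map on `E ⊗ F` defined by a bilinear map `b` such that
`⟨b(x, y), b(x', y')⟩ = ⟨x, x'⟩ ⟨y, y'⟩` is isometric. -/
def tensorLift (b : E →ₗ[ℂ] F →ₗ[ℂ] K)
    (hb : ∀ x x' y y', ⟪b x y, b x' y'⟫_ℂ = ⟪x, x'⟫_ℂ * ⟪y, y'⟫_ℂ) : E ⊗[ℂ] F →ₗᵢ[ℂ] K :=
  (TensorProduct.lift b).isometryOfInner fun z z' => by
    induction z using TensorProduct.induction_on with
    | zero => simp
    | add z₁ z₂ h₁ h₂ => rw [map_add, inner_add_left, inner_add_left, h₁, h₂]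
    | tmul x y =>
      induction z' using TensorProduct.induction_on with
      | zero => simp
      | add z₁ z₂ h₁ h₂ => rw [map_add, inner_add_right, inner_add_right, h₁, h₂]
      | tmul x' y' => simp [hb]

/-- The continuous extension to `E ⊗ F`, a Hilbert space tensor product, of such a map. -/
def hilbertTensorLift [CompleteSpace K] (b : E →ₗ[ℂ] F →ₗ[ℂ] K)
    (hb : ∀ x x' y y', ⟪b x y, b x' y'⟫_ℂ = ⟪x, x'⟫_ℂ * ⟪y, y'⟫_ℂ) :
    HilbertTensor E F →L[ℂ] K :=
  (tensorLift b hb).toContinuousLinearMap.fromCompletion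

/-- The map `f ⊗ id : E ⊗ F → ℂ ⊗ F = F` for a bounded functional `f` on `E`. -/
def functionalTensorId [CompleteSpace F] (f : E →L[ℂ] ℂ) : HilbertTensor E F →L[ℂ] F :=
  ((TensorProduct.lidIsometry ℂ F).toLinearIsometry.toContinuousLinearMap ∘L
    f.rTensor F).fromCompletion

end Tensor

section HilbertSum

variable {ι κ : Type*} {K : κ → Type*} [∀ i, NormedAddCommGroup (K i)]
  [∀ i, InnerProductSpace ℂ (K i)]

open Classical in
/-- The inclusion of one summand into a Hilbert space direct sum. -/
def summand (K : κ → Type*) [∀ i, NormedAddCommGroup (K i)] [∀ i, InnerProductSpace ℂ (K i)]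
    (i : κ) : K i →ₗᵢ[ℂ] lp K 2 where
  toLinearMap := lp.lsingle 2 i
  norm_map' x := lp.norm_single (by norm_num) i x

theorem summand_orthogonal (f : ι ↪ κ) :
    OrthogonalFamily ℂ (fun i => K (f i)) (fun i => summand K (f i)) := by
  classical
  intro i j hij x y
  have h : f i ≠ f j := fun h => hij (f.injective h)
  change ⟪lp.single 2 (f i) x, lp.single 2 (f j) y⟫_ℂ = 0
  rw [lp.inner_single_left, lp.single_apply_ne _ _ _ h, inner_zero_right]

/-- The inclusion of the Hilbert space direct sum of a subfamily into the whole direct sum. -/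
def subsum [∀ i, CompleteSpace (K i)] (f : ι ↪ κ) : lp (fun i => K (f i)) 2 →ₗᵢ[ℂ] lp K 2 :=
  (summand_orthogonal f).linearIsometry

end HilbertSum

/-! ### The `G`-free product of pointed Hilbert spaces -/

/-- A bundled complex inner product space. -/
structure InnerSpace : Type (u + 1) where
  carrier : Type u
  [group : NormedAddCommGroup carrier]
  [inner : InnerProductSpace ℂ carrier]

attribute [instance] InnerSpace.group InnerSpace.inner

section Product

variable {V : Type*} (G : Digraph V) (H : V → Type u) [∀ v, NormedAddCommGroup (H v)]
  [∀ v, InnerProductSpace ℂ (H v)] (ξ : ∀ v, H v)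

/-- `H_v°`, the orthogonal complement of `ℂ ξ_v` in `H_v`. -/
abbrev Circ (v : V) : Submodule ℂ (H v) := (ℂ ∙ ξ v)ᗮ

/-- The algebraic tensor product `H_{v_0}° ⊗ ⋯ ⊗ H_{v_m}°`, with its inner product, for a list
`[v_0, …, v_m]`; for the empty list it is a copy of `ℂ`. -/
def algTensor : List V → InnerSpace.{u}
  | [] => ⟨EuclideanSpace ℂ PUnit.{u + 1}⟩
  | v :: p => ⟨Circ H ξ v ⊗[ℂ] (algTensor p).carrier⟩

/-- The Hilbert space tensor product `H_{v_0}° ⊗ ⋯ ⊗ H_{v_m}°`. -/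
abbrev PathSpace (p : List V) : Type u :=
  UniformSpace.Completion (algTensor H ξ p).carrier

/-- Reverse paths `(v_0, …, v_m)`, i.e. `v_{i+1} ⇝ v_i` for all `i`, together with an empty path. -/
abbrev ReversePath : Type _ := {p : List V // p.IsChain (fun v w => G.Adj w v)}

/-- The underlying Hilbert space of the `G`-free product,
`ℂ ξ ⊕ ⨁_{(v_0, …, v_m)} H_{v_0}° ⊗ ⋯ ⊗ H_{v_m}°`, a Hilbert space direct sum over the reverse paths
in `G`; the empty path accounts for the summand `ℂ ξ`. -/
abbrev ProductSpace : Type _ := lp (fun p : ReversePath G => PathSpace H ξ p.1) 2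

/-- The unit vector `ξ` of the `G`-free product. -/
def vacuum : ProductSpace G H ξ :=
  summand (fun p : ReversePath G => PathSpace H ξ p.1) ⟨[], .nil⟩
    ((EuclideanSpace.single PUnit.unit (1 : ℂ) : EuclideanSpace ℂ PUnit.{u + 1}) :
      UniformSpace.Completion (EuclideanSpace ℂ PUnit.{u + 1}))

/-- The reverse paths that are empty or whose first vertex `v_0` satisfies `v_0 ⇝ v`. -/
abbrev PathInto (v : V) : Type _ := {p : ReversePath G // ∀ w ∈ p.1.head?, G.Adj w v}

/-- `H_{⇝v}`, the direct sum of `ℂ ξ` and of the tensor products over the reverse paths whose first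
vertex `v_0` satisfies `v_0 ⇝ v`. -/
abbrev SpaceInto (v : V) : Type _ := lp (fun p : PathInto G v => PathSpace H ξ p.1.1) 2

variable {G} in
/-- Prepending `v` to a reverse path from which `v` can be reached. -/
def prepend (v : V) : PathInto G v ↪ ReversePath G where
  toFun p := ⟨v :: p.1.1, List.isChain_cons.2 ⟨p.2, p.1.2⟩⟩
  inj' _ _ h := Subtype.ext (Subtype.ext (List.tail_eq_of_cons_eq (congrArg Subtype.val h)))

/-- The inclusion `H_{⇝v} ⊆ H`. -/
def inclInto (v : V) : SpaceInto G H ξ v →ₗᵢ[ℂ] ProductSpace G H ξ :=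
  subsum (K := fun p : ReversePath G => PathSpace H ξ p.1)
    (Function.Embedding.subtype fun p : ReversePath G => ∀ w ∈ p.1.head?, G.Adj w v)

/-- The map `t ↦ y ⊗ t` from `H_{v_0}° ⊗ ⋯ ⊗ H_{v_m}°` to `H_v° ⊗ H_{v_0}° ⊗ ⋯ ⊗ H_{v_m}°`, for
`y` in `H_v°`. -/
def prependTensor (v : V) (p : List V) (y : Circ H ξ v) :
    PathSpace H ξ p →L[ℂ] PathSpace H ξ (v :: p) :=
  tensorLeft (algTensor H ξ p).carrier y

theorem memℓp_prependTensor (v : V) (y : Circ H ξ v) (t : SpaceInto G H ξ v) :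
    Memℓp (fun p : PathInto G v => prependTensor H ξ v p.1.1 y (t p)) 2 :=
  ((lp.memℓp t).norm.const_smul ‖y‖).mono fun p => (norm_tensorLeft y (t p)).le

/-- The bilinear map `(y, t) ↦ y ⊗ t` from `H_v° × H_{⇝v}` to the direct sum of the spaces
`H_v° ⊗ H_{v_0}° ⊗ ⋯ ⊗ H_{v_m}°` over the reverse paths `(v_0, …, v_m)` with `v_0 ⇝ v` (and the
empty one), where the tensor product is distributed over the direct sum. -/
def distribute (v : V) : Circ H ξ v →ₗ[ℂ] SpaceInto G H ξ v →ₗ[ℂ]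
    lp (fun p : PathInto G v => PathSpace H ξ (prepend v p).1) 2 :=
  LinearMap.mk₂ ℂ
    (fun y t => ⟨fun p => prependTensor H ξ v p.1.1 y (t p), memℓp_prependTensor G H ξ v y t⟩)
    (fun y y' t => lp.ext <| funext fun p => tensorLeft_add y y' (t p))
    (fun c y t => lp.ext <| funext fun p => tensorLeft_smul c y (t p))
    (fun y t t' => lp.ext <| funext fun p => map_add (prependTensor H ξ v p.1.1 y) (t p) (t' p))
    (fun c y t => lp.ext <| funext fun p => map_smul (prependTensor H ξ v p.1.1 y) c (t p))

theorem inner_distribute (v : V) (y y' : Circ H ξ v) (t t' : SpaceInto G H ξ v) :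
    ⟪distribute G H ξ v y t, distribute G H ξ v y' t'⟫_ℂ = ⟪y, y'⟫_ℂ * ⟪t, t'⟫_ℂ := by
  rw [lp.inner_eq_tsum, lp.inner_eq_tsum, ← tsum_mul_left]
  exact tsum_congr fun p => inner_tensorLeft y y' (t p) (t' p)

/-- The isometric inclusion `H_v° ⊗ H_{⇝v} → H` onto the direct sum of the tensor products over the
reverse paths that start with `v`. -/
def inclFrom (v : V) : HilbertTensor (Circ H ξ v) (SpaceInto G H ξ v) →L[ℂ] ProductSpace G H ξ :=
  (subsum (K := fun p : ReversePath G => PathSpace H ξ p.1) (prepend v)).toContinuousLinearMap ∘L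
    hilbertTensorLift (distribute G H ξ v) (inner_distribute G H ξ v)

/-- The restriction of `u_v^*` to `H_v ⊗ H_{⇝v} = (ℂ ξ_v ⊕ H_v°) ⊗ H_{⇝v}`: it identifies
`ℂ ξ_v ⊗ H_{⇝v}` with `H_{⇝v} ⊆ H`, and `H_v° ⊗ H_{⇝v}` with the direct sum of the tensor products
over the reverse paths that start with `v`. That is,
`x ⊗ t ↦ ⟨ξ_v, x⟩ t + (x - ⟨ξ_v, x⟩ ξ_v) ⊗ t`. If `G` has no loops and `ξ_v` is a unit vector, then it
is an isometry, and its range is the orthogonal complement of `H_{⊥v}`. -/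
def leg (v : V) : HilbertTensor (H v) (SpaceInto G H ξ v) →L[ℂ] ProductSpace G H ξ :=
  (inclInto G H ξ v).toContinuousLinearMap ∘L functionalTensorId (innerSL ℂ (ξ v)) +
    inclFrom G H ξ v ∘L tensorId (SpaceInto G H ξ v) (Circ H ξ v).orthogonalProjectionOnto

/-- The map `ι_v : B(H_v) → B(H)`, `ι_v(a) = u_v^* ((a ⊗ id_{H_{⇝v}}) ⊕ 0_{H_{⊥v}}) u_v`. -/
def iota [∀ v, CompleteSpace (H v)] (v : V) (a : H v →L[ℂ] H v) :
    ProductSpace G H ξ →L[ℂ] ProductSpace G H ξ :=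
  leg G H ξ v ∘L tensorId (SpaceInto G H ξ v) a ∘L (leg G H ξ v).adjoint

/-! ### The contribution of a block -/

variable {H} in
/-- Transport of an operator along an equality of vertices. -/
def castOp {v w : V} (h : v = w) (a : H v →L[ℂ] H v) : H w →L[ℂ] H w := h ▸ a

variable {G H} in
/-- The family `(a_j : j ∈ B)` in increasing order of the indices, as operators on `H_{ℓ(B)}`. -/
def blockOps {k : ℕ} {ℓ : Fin k → V} (a : ∀ j, H (ℓ j) →L[ℂ] H (ℓ j)) (π : NC ℓ G)
    (B : π.1.parts) (i : Fin B.1.card) :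
    H (π.1.blockLabel ℓ B) →L[ℂ] H (π.1.blockLabel ℓ B) :=
  castOp (π.2.isConstantOnBlocks.eq_blockLabel B (B.1.orderEmbOfFin_mem rfl i))
    (a (B.1.orderEmbOfFin rfl i))

end Product

end

end GFree

/-! Apply the operators to ξ from right to left. On the summand of a reverse path `p`, ι_v(a) acts
in one of three ways. If `p` is empty or its first vertex has an edge to `v`, then t ↦ ⟨ξ_v, aξ_v⟩ t
+ (aξ_v)° ⊗ t (`iota_pathInto`), where x° is the component of x in H_v°. If `p` starts with `v`,
then y ⊗ t ↦ ⟨ξ_v, ay⟩ t + (ay)° ⊗ t (`iota_prepend`). Otherwise the result is 0 (`iota_eq_zero`).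
Since there are no loops, the cases exclude each other.

This is a stack machine. Each tensor factor is an open block, the first factor being the top of the
stack. The operator with index j starts a new block on top or joins the top block; the scalar term
then closes the block of j, and the other term keeps it open. With Q = 1 - |ξ_v⟩⟨ξ_v|, an open block
j₁ < ⋯ < jₘ stores Q a_{j₁} Q ⋯ Q a_{jₘ} ξ_v, and closing it yields ⟨ξ_v, a_{j₁} Q ⋯ Q a_{jₘ} ξ_v⟩.
Expanding every Q cuts the block into intervals, with one sign per cut, so this scalar is the
boolean cumulant (`booleanCumulant_vectorState`). Hence the vector is a sum over the runs of the
machine (`prod_iota_vacuum`), and pairing with ξ keeps the runs that end with an empty stack.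

It remains to identify these runs with NC_k(ℓ, G). The stack discipline is non-crossing, and the
edge tested when a block is pushed is the one from the block that will cover it in the nesting
forest. For the induction, partially built partitions are described by `Good`, where nesting is
replaced by `Anc`, which also counts the nestings that an open block will acquire once it grows to
the left. Every move preserves `Good` and can be undone within `Good` (`Good.push`, `Good.of_push`,
`Good.extend`, `Good.of_extend`, `good_close_iff`), so the reachable states are the good ones
(`mem_states`). A state determines its predecessor (`step_injective`), so none is counted twice. -/

namespace GFree

universe u

noncomputable section

/-! ### Orthogonality in Hilbert space direct sums -/

section HilbertSumLemmas

variable {ι κ : Type*} {K : κ → Type*} [∀ i, NormedAddCommGroup (K i)]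
  [∀ i, InnerProductSpace ℂ (K i)]

theorem summand_eq_single [DecidableEq κ] (i : κ) (x : K i) :
    summand K i x = lp.single 2 i x := by
  change @lp.single _ K _ (fun i j => Classical.propDecidable (i = j)) 2 i x = _
  congr!

theorem inner_summand_eq_zero {i j : κ} (h : i ≠ j) (x : K i) (y : K j) :
    ⟪summand K i x, summand K j y⟫_ℂ = 0 :=
  summand_orthogonal (K := K) (Function.Embedding.refl κ) h x y

variable [∀ i, CompleteSpace (K i)]

theorem subsum_summand (f : ι ↪ κ) (i : ι) (x : K (f i)) :
    subsum f (summand (fun i => K (f i)) i x) = summand K (f i) x := by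
  classical
  rw [summand_eq_single]
  exact (summand_orthogonal (K := K) f).linearIsometry_apply_single x

theorem inner_subsum_eq_zero (f : ι ↪ κ) (z : lp (fun i => K (f i)) 2) (u : lp K 2)
    (h : ∀ i, ⟪summand K (f i) (z i), u⟫_ℂ = 0) : ⟪subsum f z, u⟫_ℂ = 0 := by
  have hs := (summand_orthogonal (K := K) f).hasSum_linearIsometry z
  have h1 : HasSum (fun i => ⟪u, summand K (f i) (z i)⟫_ℂ) ⟪u, subsum f z⟫_ℂ :=
    hs.mapL (innerSL ℂ u)
  have h2 : ∀ i, ⟪u, summand K (f i) (z i)⟫_ℂ = 0 := fun i => inner_eq_zero_symm.1 (h i)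
  simp only [h2] at h1
  exact inner_eq_zero_symm.1 (h1.unique hasSum_zero)

theorem inner_subsum_summand_eq_zero (f : ι ↪ κ) (z : lp (fun i => K (f i)) 2) {p : κ}
    (hp : ∀ i, f i ≠ p) (t : K p) : ⟪subsum f z, summand K p t⟫_ℂ = 0 :=
  inner_subsum_eq_zero f z _ fun i => inner_summand_eq_zero (hp i) _ _

theorem inner_subsum_subsum_eq_zero {ι' : Type*} (f : ι ↪ κ) (g : ι' ↪ κ)
    (hfg : ∀ i j, f i ≠ g j) (z : lp (fun i => K (f i)) 2) (w : lp (fun i => K (g i)) 2) :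
    ⟪subsum f z, subsum g w⟫_ℂ = 0 :=
  inner_subsum_eq_zero f z _ fun i => inner_eq_zero_symm.1
    (inner_subsum_summand_eq_zero g w (fun j => (hfg i j).symm) _)

end HilbertSumLemmas

/-! ### The action of ι_v on the summands of the G-free product -/

section Action

variable {V : Type*} (G : Digraph V) (H : V → Type u) [∀ v, NormedAddCommGroup (H v)]
  [∀ v, InnerProductSpace ℂ (H v)] (ξ : ∀ v, H v)

/-- The projection of `H_v` onto `H_v°`. -/
abbrev toCirc (v : V) : H v →L[ℂ] Circ H ξ v := (Circ H ξ v).orthogonalProjectionOnto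

theorem coe_toCirc {v : V} (hξ : ‖ξ v‖ = 1) (x : H v) :
    (toCirc H ξ v x : H v) = x - ⟪ξ v, x⟫_ℂ • ξ v := by
  have h := Submodule.starProjection_orthogonal_val (K := ℂ ∙ ξ v) x
  rw [Submodule.starProjection_unit_singleton ℂ hξ] at h
  exact h

theorem toCirc_self {v : V} (hξ : ‖ξ v‖ = 1) : toCirc H ξ v (ξ v) = 0 := by
  apply Subtype.ext
  rw [coe_toCirc H ξ hξ, inner_self_eq_norm_sq_to_K, hξ]
  simp

theorem toCirc_coe {v : V} (y : Circ H ξ v) : toCirc H ξ v (y : H v) = y :=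
  Submodule.orthogonalProjectionOnto_mem_subspace_eq_self y

theorem inner_coe_circ {v : V} (y : Circ H ξ v) : ⟪ξ v, (y : H v)⟫_ℂ = 0 :=
  Submodule.mem_orthogonal_singleton_iff_inner_right.1 y.2

/-- Pythagoras for H_v = ℂξ_v ⊕ H_v°; this is what makes `leg` isometric. -/
theorem inner_toCirc {v : V} (hξ : ‖ξ v‖ = 1) (x x' : H v) :
    ⟪x, ξ v⟫_ℂ * ⟪ξ v, x'⟫_ℂ + ⟪toCirc H ξ v x, toCirc H ξ v x'⟫_ℂ = ⟪x, x'⟫_ℂ := by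
  rw [Submodule.coe_inner, coe_toCirc H ξ hξ, coe_toCirc H ξ hξ]
  simp only [inner_sub_left, inner_sub_right, inner_smul_left, inner_smul_right,
    inner_self_eq_norm_sq_to_K, hξ, inner_conj_symm]
  push_cast
  ring

variable {H} in
/-- The pure tensor `x ⊗ s` in `H_v ⊗ H_{⇝v}`. -/
def pureTensor {v : V} (x : H v) (s : SpaceInto G H ξ v) : HilbertTensor (H v) (SpaceInto G H ξ v) :=
  ((x ⊗ₜ[ℂ] s : H v ⊗[ℂ] SpaceInto G H ξ v) : HilbertTensor (H v) (SpaceInto G H ξ v))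

theorem tensorId_pureTensor {v : V} (a : H v →L[ℂ] H v) (x : H v) (s : SpaceInto G H ξ v) :
    tensorId (SpaceInto G H ξ v) a (pureTensor G ξ x s) = pureTensor G ξ (a x) s :=
  ContinuousLinearMap.completion_apply_coe _ _

/-- The inclusion of the direct sum over the reverse paths that start with `v`. -/
def inclPrepend (v : V) :
    lp (fun p : PathInto G v => PathSpace H ξ (v :: p.1.1)) 2 →ₗᵢ[ℂ] ProductSpace G H ξ :=
  subsum (K := fun p : ReversePath G => PathSpace H ξ p.1) (prepend v)

variable {G H ξ} in
/-- The element `y ⊗ t` of the direct sum over the reverse paths that start with `v`. -/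
def distrib {v : V} (y : Circ H ξ v) (t : SpaceInto G H ξ v) :
    lp (fun p : PathInto G v => PathSpace H ξ (v :: p.1.1)) 2 :=
  distribute G H ξ v y t

theorem inner_distrib {v : V} (y y' : Circ H ξ v) (t t' : SpaceInto G H ξ v) :
    ⟪distrib y t, distrib y' t'⟫_ℂ = ⟪y, y'⟫_ℂ * ⟪t, t'⟫_ℂ :=
  inner_distribute G H ξ v y y' t t'

/-- The inclusion of the summand of a reverse path into the `G`-free product. -/
abbrev pathIncl (p : ReversePath G) : PathSpace H ξ p.1 →ₗᵢ[ℂ] ProductSpace G H ξ :=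
  summand (fun p : ReversePath G => PathSpace H ξ p.1) p

/-- A reverse path that starts with `v` and also occurs in H_{⇝v} would give a loop at `v`, so the
two families of summands are disjoint. -/
theorem inner_inclInto_inclPrepend {v : V} (hG : ¬ G.Adj v v) (s : SpaceInto G H ξ v)
    (t : lp (fun p : PathInto G v => PathSpace H ξ (v :: p.1.1)) 2) :
    ⟪inclInto G H ξ v s, inclPrepend G H ξ v t⟫_ℂ = 0 := by
  refine inner_subsum_subsum_eq_zero (K := fun p : ReversePath G => PathSpace H ξ p.1)
    (Function.Embedding.subtype fun p : ReversePath G => ∀ w ∈ p.1.head?, G.Adj w v)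
    (prepend v) ?_ s t
  intro p q h
  have h' : p.1 = prepend v q := h
  have := p.2
  rw [h'] at this
  exact hG (this v rfl)

theorem inclInto_summand {v : V} (p : PathInto G v) (t : PathSpace H ξ p.1.1) :
    inclInto G H ξ v (summand (fun p : PathInto G v => PathSpace H ξ p.1.1) p t) =
      pathIncl G H ξ p.1 t :=
  subsum_summand (K := fun p : ReversePath G => PathSpace H ξ p.1)
    (Function.Embedding.subtype fun p : ReversePath G => ∀ w ∈ p.1.head?, G.Adj w v) p t

theorem inner_inclInto_pathIncl {v : V} (s : SpaceInto G H ξ v) (p : ReversePath G)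
    (hp : ¬ ∀ w ∈ p.1.head?, G.Adj w v) (t : PathSpace H ξ p.1) :
    ⟪inclInto G H ξ v s, pathIncl G H ξ p t⟫_ℂ = 0 := by
  refine inner_subsum_summand_eq_zero (K := fun p : ReversePath G => PathSpace H ξ p.1)
    (Function.Embedding.subtype fun p : ReversePath G => ∀ w ∈ p.1.head?, G.Adj w v) s ?_ t
  rintro q rfl
  exact hp q.2

theorem inner_inclPrepend_pathIncl {v : V}
    (s : lp (fun p : PathInto G v => PathSpace H ξ (v :: p.1.1)) 2) (p : ReversePath G)
    (hp : v ∉ p.1.head?) (t : PathSpace H ξ p.1) :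
    ⟪inclPrepend G H ξ v s, pathIncl G H ξ p t⟫_ℂ = 0 := by
  refine inner_subsum_summand_eq_zero (K := fun p : ReversePath G => PathSpace H ξ p.1)
    (prepend v) s ?_ t
  rintro q rfl
  exact hp rfl

variable {G} in
/-- The inclusion of the summand of the reverse path `v :: p` into the `G`-free product. -/
def consIncl {v : V} (p : PathInto G v) : PathSpace H ξ (v :: p.1.1) →ₗᵢ[ℂ] ProductSpace G H ξ :=
  pathIncl G H ξ (prepend v p)

theorem inclPrepend_summand {v : V} (p : PathInto G v) (t : PathSpace H ξ (v :: p.1.1)) :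
    inclPrepend G H ξ v (summand (fun p : PathInto G v => PathSpace H ξ (v :: p.1.1)) p t) =
      consIncl H ξ p t :=
  subsum_summand (K := fun p : ReversePath G => PathSpace H ξ p.1) (prepend v) p t

theorem distrib_summand {v : V} (y : Circ H ξ v) (p : PathInto G v) (t : PathSpace H ξ p.1.1) :
    distrib y (summand (fun p : PathInto G v => PathSpace H ξ p.1.1) p t) =
      summand (fun p : PathInto G v => PathSpace H ξ (v :: p.1.1)) p
        (prependTensor H ξ v p.1.1 y t) := by
  classical
  rw [summand_eq_single, summand_eq_single]
  refine lp.ext (funext fun q => ?_)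
  change prependTensor H ξ v q.1.1 _ _ = _
  by_cases hq : q = p
  · subst hq
    rw [lp.single_apply_self, lp.single_apply_self]
  · rw [lp.single_apply_ne _ _ _ hq, lp.single_apply_ne _ _ _ hq, map_zero]

theorem leg_pureTensor {v : V} (x : H v) (s : SpaceInto G H ξ v) :
    leg G H ξ v (pureTensor G ξ x s) = ⟪ξ v, x⟫_ℂ • inclInto G H ξ v s +
      inclPrepend G H ξ v (distrib (toCirc H ξ v x) s) := by
  have h1 : functionalTensorId (innerSL ℂ (ξ v)) (pureTensor G ξ x s) = ⟪ξ v, x⟫_ℂ • s := by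
    simp only [functionalTensorId, pureTensor]
    rw [ContinuousLinearMap.fromCompletion_apply_coe]
    simp
  have h2 : tensorId (SpaceInto G H ξ v) (toCirc H ξ v) (pureTensor G ξ x s) =
      ((toCirc H ξ v x ⊗ₜ[ℂ] s : Circ H ξ v ⊗[ℂ] SpaceInto G H ξ v) :
        HilbertTensor (Circ H ξ v) (SpaceInto G H ξ v)) :=
    ContinuousLinearMap.completion_apply_coe _ _
  have h3 : ∀ y : Circ H ξ v, hilbertTensorLift (distribute G H ξ v) (inner_distribute G H ξ v)
      ((y ⊗ₜ[ℂ] s : Circ H ξ v ⊗[ℂ] SpaceInto G H ξ v) :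
        HilbertTensor (Circ H ξ v) (SpaceInto G H ξ v)) = distribute G H ξ v y s := by
    intro y
    rw [hilbertTensorLift, ContinuousLinearMap.fromCompletion_apply_coe]
    simp [tensorLift]
  simp only [leg, add_apply, ContinuousLinearMap.comp_apply]
  rw [h1, h2, inclFrom, ContinuousLinearMap.comp_apply, h3]
  simp only [map_smul]
  rfl

variable {G} {H} {ξ}

/-- The cross terms vanish because the two ranges are orthogonal, and the diagonal terms add up by
`inner_toCirc`. -/
theorem inner_leg_pureTensor {v : V} (hG : ¬ G.Adj v v) (hξ : ‖ξ v‖ = 1) (x x' : H v)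
    (s s' : SpaceInto G H ξ v) :
    ⟪leg G H ξ v (pureTensor G ξ x s), leg G H ξ v (pureTensor G ξ x' s')⟫_ℂ = ⟪x, x'⟫_ℂ * ⟪s, s'⟫_ℂ := by
  have h1 := inner_inclInto_inclPrepend G H ξ hG
  have h2 := fun s t => inner_eq_zero_symm.1 (h1 s t)
  rw [leg_pureTensor, leg_pureTensor, inner_add_left, inner_add_right, inner_add_right]
  simp only [inner_smul_left, inner_smul_right, LinearIsometry.inner_map_map, inner_distrib]
  rw [h1, h2, ← inner_toCirc H ξ hξ x x', inner_conj_symm]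
  ring

variable [∀ v, CompleteSpace (H v)]

omit [∀ v, CompleteSpace (H v)] in
theorem leg_induction {v : V} {P : HilbertTensor (H v) (SpaceInto G H ξ v) → Prop}
    (hc : IsClosed {z | P z}) (h0 : P 0) (hp : ∀ x s, P (pureTensor G ξ x s))
    (ha : ∀ z z', P z → P z' → P (z + z')) (z) : P z := by
  induction z using UniformSpace.Completion.induction_on with
  | hp => exact hc
  | ih z =>
    induction z using TensorProduct.induction_on with
    | zero => exact h0
    | tmul x s => exact hp x s
    | add z z' h h' => rw [UniformSpace.Completion.coe_add]; exact ha _ _ h h'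

-- An isometry is inverted on its range by its adjoint. Thus ι_v(a) can be computed on any vector
-- written as `leg` of a pure tensor, without a formula for the adjoint.
omit [∀ v, CompleteSpace (H v)] in
theorem adjoint_leg_leg_pureTensor {v : V} (hG : ¬ G.Adj v v) (hξ : ‖ξ v‖ = 1) (x : H v)
    (s : SpaceInto G H ξ v) :
    (leg G H ξ v).adjoint (leg G H ξ v (pureTensor G ξ x s)) = pureTensor G ξ x s := by
  refine ext_inner_left ℂ fun z => ?_
  rw [ContinuousLinearMap.adjoint_inner_right]
  induction z using leg_induction with
  | hc => exact isClosed_eq (by fun_prop) (by fun_prop)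
  | h0 => simp
  | hp x' s' =>
    rw [inner_leg_pureTensor hG hξ]
    simp [pureTensor]
  | ha z z' h h' => rw [map_add, inner_add_left, inner_add_left, h, h']

theorem iota_leg_pureTensor {v : V} (hG : ¬ G.Adj v v) (hξ : ‖ξ v‖ = 1) (a : H v →L[ℂ] H v) (x : H v)
    (s : SpaceInto G H ξ v) :
    iota G H ξ v a (leg G H ξ v (pureTensor G ξ x s)) = leg G H ξ v (pureTensor G ξ (a x) s) := by
  simp only [iota, ContinuousLinearMap.comp_apply]
  rw [adjoint_leg_leg_pureTensor hG hξ, tensorId_pureTensor]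

omit [∀ v, CompleteSpace (H v)] in
theorem leg_pureTensor_summand {v : V} (x : H v) (p : PathInto G v) (t : PathSpace H ξ p.1.1) :
    leg G H ξ v (pureTensor G ξ x (summand (fun p : PathInto G v => PathSpace H ξ p.1.1) p t)) =
      ⟪ξ v, x⟫_ℂ • pathIncl G H ξ p.1 t +
        consIncl H ξ p (prependTensor H ξ v p.1.1 (toCirc H ξ v x) t) := by
  rw [leg_pureTensor, distrib_summand, inclPrepend_summand, inclInto_summand]

/-- `ι_v(a)` on the summand of a reverse path from which `v` can be reached. -/
theorem iota_pathInto {v : V} (hG : ¬ G.Adj v v) (hξ : ‖ξ v‖ = 1) (a : H v →L[ℂ] H v)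
    (p : PathInto G v) (t : PathSpace H ξ p.1.1) :
    iota G H ξ v a (pathIncl G H ξ p.1 t) = ⟪ξ v, a (ξ v)⟫_ℂ • pathIncl G H ξ p.1 t +
      consIncl H ξ p (prependTensor H ξ v p.1.1 (toCirc H ξ v (a (ξ v))) t) := by
  -- The vector t is the image of ξ_v ⊗ t, because ξ_v has no component in H_v°.
  have h := leg_pureTensor_summand (ξ := ξ) (ξ v) p t
  rw [toCirc_self H ξ hξ, inner_self_eq_norm_sq_to_K, hξ] at h
  have h0 : prependTensor H ξ v p.1.1 0 t = 0 := by
    rw [← norm_eq_zero]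
    exact (norm_tensorLeft (0 : Circ H ξ v) t).trans (by simp)
  rw [h0, map_zero, add_zero] at h
  simp only [RCLike.ofReal_one, one_pow, one_smul] at h
  rw [← h, iota_leg_pureTensor hG hξ, leg_pureTensor_summand, h]

/-- `ι_v(a)` on the summand of a reverse path that starts with `v`. -/
theorem iota_prepend {v : V} (hG : ¬ G.Adj v v) (hξ : ‖ξ v‖ = 1) (a : H v →L[ℂ] H v)
    (p : PathInto G v) (y : Circ H ξ v) (t : PathSpace H ξ p.1.1) :
    iota G H ξ v a (consIncl H ξ p (prependTensor H ξ v p.1.1 y t)) =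
      ⟪ξ v, a y⟫_ℂ • pathIncl G H ξ p.1 t +
      consIncl H ξ p (prependTensor H ξ v p.1.1 (toCirc H ξ v (a y)) t) := by
  have h := leg_pureTensor_summand (ξ := ξ) (y : H v) p t
  rw [toCirc_coe, inner_coe_circ, zero_smul, zero_add] at h
  rw [← h, iota_leg_pureTensor hG hξ, leg_pureTensor_summand]

/-- `ι_v(a)` vanishes on `H_{⊥v}`. -/
theorem iota_eq_zero {v : V} (a : H v →L[ℂ] H v) (p : ReversePath G)
    (hp : ∃ w ∈ p.1.head?, w ≠ v ∧ ¬ G.Adj w v) (t : PathSpace H ξ p.1) :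
    iota G H ξ v a (pathIncl G H ξ p t) = 0 := by
  obtain ⟨w, hw, hwv, hadj⟩ := hp
  -- The summand is orthogonal to the range of `leg`; by density, pure tensors suffice to test this.
  have h : (leg G H ξ v).adjoint (pathIncl G H ξ p t) = 0 := by
    refine ext_inner_left ℂ fun z => ?_
    rw [ContinuousLinearMap.adjoint_inner_right, inner_zero_right]
    induction z using leg_induction with
    | hc => exact isClosed_eq (by fun_prop) (by fun_prop)
    | h0 => simp
    | hp x s =>
      rw [leg_pureTensor, inner_add_left, inner_smul_left, inner_inclInto_pathIncl,
        inner_inclPrepend_pathIncl]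
      · simp
      · intro hv
        exact hwv (Option.mem_unique hw hv)
      · exact fun h => hadj (h w hw)
    | ha z z' h h' => rw [map_add, inner_add_left, h, h', add_zero]
  simp only [iota, ContinuousLinearMap.comp_apply]
  rw [h, map_zero, map_zero]

end Action

/-! ### Partially built non-crossing partitions -/

section States

variable {k : ℕ}

theorem nested_iff {B B' : Finset (Fin k)} : Nested B B' ↔ ∃ i ∈ B, ∃ j ∈ B, i < j ∧
    (∀ x ∈ B', i < x ∧ x < j) ∧ ∀ b ∈ B, ¬ (i < b ∧ b < j) := by
  simp only [Nested, Finset.subset_iff, Finset.mem_Ioo, Finset.disjoint_right]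

/-- A new leftmost point creates exactly one gap, between `j` and the least element of `X`, and `Z`
lies in it when all of `Z` is to the left of `X`. The second alternative in `Anc` anticipates this
gap. -/
theorem nested_insert {j : Fin k} {X Z : Finset (Fin k)} (hX : ∀ x ∈ X, j < x) (hne : X.Nonempty)
    (hZ : ∀ z ∈ Z, j < z) :
    Nested (insert j X) Z ↔ Nested X Z ∨ ∀ z ∈ Z, ∀ x ∈ X, z < x := by
  rw [nested_iff, nested_iff]
  constructor
  · rintro ⟨i, hi, m, hm, him, hZm, hdis⟩
    rcases Finset.mem_insert.1 hi with rfl | hi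
    · right
      intro z hz x hx
      have h1 := hdis x (Finset.mem_insert_of_mem hx)
      have h2 := hZm z hz
      have h3 := hX x hx
      grind
    · left
      have h1 := hX i hi
      have hm' : m ∈ X := by grind
      exact ⟨i, hi, m, hm', him, hZm, fun b hb => hdis b (Finset.mem_insert_of_mem hb)⟩
  · rintro (⟨i, hi, m, hm, him, hZm, hdis⟩ | h)
    · refine ⟨i, Finset.mem_insert_of_mem hi, m, Finset.mem_insert_of_mem hm, him, hZm, ?_⟩
      have := hX i hi
      grind
    · refine ⟨j, Finset.mem_insert_self _ _, X.min' hne,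
        Finset.mem_insert_of_mem (Finset.min'_mem _ _), hX _ (Finset.min'_mem _ _), ?_, ?_⟩
      · exact fun z hz => ⟨hZ z hz, h z hz _ (Finset.min'_mem _ _)⟩
      · intro b hb
        rcases Finset.mem_insert.1 hb with rfl | hb
        · simp
        · have := Finset.min'_le _ _ hb
          grind

theorem Nested.exists_lt {W Z : Finset (Fin k)} (h : Nested W Z) {z : Fin k} (hz : z ∈ Z) :
    ∃ w ∈ W, ∃ w' ∈ W, w < z ∧ z < w' := by
  obtain ⟨i, hi, m, hm, -, hZ, -⟩ := nested_iff.1 h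
  exact ⟨i, hi, m, hm, hZ z hz⟩

theorem not_nested_self {W : Finset (Fin k)} : ¬ Nested W W := by
  intro h
  obtain ⟨i, hi, m, hm, -, hZ, -⟩ := nested_iff.1 h
  exact lt_irrefl _ (hZ i hi).1

variable {V : Type*}

/-- The blocks of a partially built partition: the closed ones, in `C`, and the open ones, on the
stack `S`, which carries the labels of the blocks. -/
def IsBlock (C : Finset (Finset (Fin k))) (S : List (V × Finset (Fin k))) (B : Finset (Fin k)) :
    Prop :=
  B ∈ C ∨ ∃ v, (v, B) ∈ S

/-- `Z` will be nested in `W` as soon as `W` receives an element on the left of its elements, if `W`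
is open. -/
def Anc (S : List (V × Finset (Fin k))) (W Z : Finset (Fin k)) : Prop :=
  Nested W Z ∨ (∃ v, (v, W) ∈ S) ∧ ∀ z ∈ Z, ∀ w ∈ W, z < w

/-- The partially built partitions of a final segment `L` that are compatible with `ℓ` and `G`. -/
structure Good (G : Digraph V) (ℓ : Fin k → V) (L : List (Fin k)) (C : Finset (Finset (Fin k)))
    (S : List (V × Finset (Fin k))) : Prop where
  nonempty : ∀ B, IsBlock C S B → B.Nonempty
  cover : ∀ x, x ∈ L ↔ ∃ B, IsBlock C S B ∧ x ∈ B
  disj : ∀ B B' x, IsBlock C S B → IsBlock C S B' → x ∈ B → x ∈ B' → B = B'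
  sep : ∀ v X, (v, X) ∈ S → X ∉ C
  label : ∀ B x y, IsBlock C S B → x ∈ B → y ∈ B → ℓ x = ℓ y
  stackLabel : ∀ v X x, (v, X) ∈ S → x ∈ X → ℓ x = v
  sorted : S.Pairwise fun p q => ∀ x ∈ p.2, ∀ y ∈ q.2, x < y
  ncross : ∀ B B' i i' j j', IsBlock C S B → IsBlock C S B' → i ∈ B → i' ∈ B' → j ∈ B → j' ∈ B' →
    i < i' → i' < j → j < j' → B = B'
  -- No other block straddles a point of an open block; otherwise a later point of `X` on the left
  -- would produce a crossing.
  opened : ∀ v X Z x z z', (v, X) ∈ S → IsBlock C S Z → x ∈ X → z ∈ Z → z' ∈ Z → z < x → x < z' →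
    Z = X
  -- The homomorphism condition on covering pairs, stated without negation so that it can be
  -- transported along the moves.
  hom : ∀ W Z, IsBlock C S W → IsBlock C S Z → Anc S W Z →
    (∀ w ∈ W, ∀ z ∈ Z, G.Adj (ℓ w) (ℓ z)) ∨ ∃ U, IsBlock C S U ∧ Anc S W U ∧ Anc S U Z

variable {G : Digraph V} {ℓ : Fin k → V} {L : List (Fin k)} {C : Finset (Finset (Fin k))}
  {S : List (V × Finset (Fin k))} {j : Fin k} {v : V} {X : Finset (Fin k)}

theorem isBlock_cons {B : Finset (Fin k)} :
    IsBlock C ((v, X) :: S) B ↔ B = X ∨ IsBlock C S B := by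
  simp only [IsBlock, List.mem_cons, Prod.mk.injEq]
  grind

theorem isBlock_insert {B : Finset (Fin k)} :
    IsBlock (insert X C) S B ↔ B = X ∨ IsBlock C S B := by
  simp only [IsBlock, Finset.mem_insert]
  tauto

theorem Good.mem (h : Good G ℓ L C S) {B : Finset (Fin k)} (hB : IsBlock C S B) {x : Fin k}
    (hx : x ∈ B) : x ∈ L :=
  (h.cover x).2 ⟨B, hB, hx⟩

theorem Good.not_isBlock (h : Good G ℓ L C ((v, X) :: S)) : ¬ IsBlock C S X := by
  rintro (hX | ⟨w, hw⟩)
  · exact h.sep v X List.mem_cons_self hX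
  · obtain ⟨x, hx⟩ := h.nonempty X (isBlock_cons.2 (.inl rfl))
    exact lt_irrefl _ ((List.pairwise_cons.1 h.sorted).1 _ hw x hx x hx)

theorem anc_cons_of_ne {W Z : Finset (Fin k)} (hW : W ≠ X) :
    Anc ((v, X) :: S) W Z ↔ Anc S W Z := by
  simp only [Anc, List.mem_cons, Prod.mk.injEq]
  grind

/-- Whether `X` is open matters only for blocks lying wholly to the left of `X`, and none does when
`X` contains a point that is minimal among those considered. -/
theorem anc_close (hj : j ∈ X) {W Z : Finset (Fin k)} (hZ : ∀ z ∈ Z, j ≤ z) (hne : Z.Nonempty) :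
    Anc ((v, X) :: S) W Z ↔ Anc S W Z := by
  by_cases hW : W = X
  · subst hW
    obtain ⟨z, hz⟩ := hne
    have h : ¬ ∀ z ∈ Z, ∀ w ∈ W, z < w := fun h => (h z hz j hj).not_ge (hZ z hz)
    simp [Anc, h]
  · exact anc_cons_of_ne hW

/-- The block of the leftmost point `j` can be opened or closed freely: the extra conditions on an
open top block follow from non-crossing and from `opened` for the other open blocks, with `j` as the
left witness. The moves therefore need be studied only for a block that stays open. -/
theorem good_close_iff (hj : j ∈ X) (hL : ∀ x ∈ L, j ≤ x) (hXC : X ∉ C) :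
    Good G ℓ L (insert X C) S ∧ (∀ v, (v, X) ∉ S) ↔ Good G ℓ L C ((ℓ j, X) :: S) := by
  have hB : ∀ B, IsBlock (insert X C) S B ↔ IsBlock C ((ℓ j, X) :: S) B := fun B => by
    rw [isBlock_insert, isBlock_cons]
  constructor
  · rintro ⟨h, hXS⟩
    have hX : IsBlock (insert X C) S X := isBlock_insert.2 (.inl rfl)
    have hle : ∀ B, IsBlock (insert X C) S B → ∀ x ∈ B, j ≤ x := fun B hB x hx => hL x (h.mem hB hx)
    refine ⟨?_, ?_, ?_, ?_, ?_, ?_, ?_, ?_, ?_, ?_⟩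
    · simpa only [hB] using h.nonempty
    · simpa only [hB] using h.cover
    · simpa only [hB] using h.disj
    · have := h.sep
      grind
    · simpa only [hB] using h.label
    · intro v Y x hY hx
      rcases List.mem_cons.1 hY with hY | hY
      · obtain ⟨rfl, rfl⟩ := Prod.mk.inj hY
        exact h.label _ x j hX hx hj
      · exact h.stackLabel v Y x hY hx
    · refine List.pairwise_cons.2 ⟨?_, h.sorted⟩
      rintro ⟨w, Y⟩ hY x hx y hy
      by_contra hxy
      have hYX : Y ≠ X := by rintro rfl; exact hXS _ hY
      have hY' : IsBlock (insert X C) S Y := .inr ⟨w, hY⟩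
      have h1 : j ≠ y := by rintro rfl; exact hYX (h.disj _ _ _ hY' hX hy hj)
      have h2 : y ≠ x := by rintro rfl; exact hYX (h.disj _ _ _ hY' hX hy hx)
      exact hYX (h.opened w Y X y j x hY hX hy hj hx (lt_of_le_of_ne (hle _ hY' y hy) h1)
        (lt_of_le_of_ne (not_lt.1 hxy) h2)).symm
    · simpa only [hB] using h.ncross
    · intro v Y Z x z z' hY hZ hx hz hz' hzx hxz
      rw [← hB] at hZ
      rcases List.mem_cons.1 hY with hY | hY
      · obtain ⟨rfl, rfl⟩ := Prod.mk.inj hY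
        rcases (hle Z hZ z hz).eq_or_lt with rfl | hlt
        · exact h.disj _ _ _ hZ hX hz hj
        · exact (h.ncross _ _ _ _ _ _ hX hZ hj hz hx hz' hlt hzx hxz).symm
      · exact h.opened v Y Z x z z' hY hZ hx hz hz' hzx hxz
    · intro W Z hW hZ hWZ
      rw [← hB] at hW hZ
      rw [anc_close hj (hle Z hZ) (h.nonempty Z hZ)] at hWZ
      refine (h.hom W Z hW hZ hWZ).imp_right ?_
      rintro ⟨U, hU, h1, h2⟩
      exact ⟨U, (hB U).1 hU, (anc_close hj (hle U hU) (h.nonempty U hU)).2 h1,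
        (anc_close hj (hle Z hZ) (h.nonempty Z hZ)).2 h2⟩
  · intro h
    have hle : ∀ B, IsBlock C ((ℓ j, X) :: S) B → ∀ x ∈ B, j ≤ x :=
      fun B hB x hx => hL x (h.mem hB hx)
    have hXS : ∀ v, (v, X) ∉ S := fun v hv => h.not_isBlock (.inr ⟨v, hv⟩)
    refine ⟨⟨?_, ?_, ?_, ?_, ?_, ?_, ?_, ?_, ?_, ?_⟩, hXS⟩
    · simpa only [hB] using h.nonempty
    · simpa only [hB] using h.cover
    · simpa only [hB] using h.disj
    · have := h.sep
      grind
    · simpa only [hB] using h.label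
    · exact fun v Y x hY hx => h.stackLabel v Y x (List.mem_cons_of_mem _ hY) hx
    · exact (List.pairwise_cons.1 h.sorted).2
    · simpa only [hB] using h.ncross
    · exact fun v Y Z x z z' hY hZ => h.opened v Y Z x z z' (List.mem_cons_of_mem _ hY) ((hB Z).1 hZ)
    · intro W Z hW hZ hWZ
      rw [hB] at hW hZ
      rw [← anc_close (v := ℓ j) hj (hle Z hZ) (h.nonempty Z hZ)] at hWZ
      refine (h.hom W Z hW hZ hWZ).imp_right ?_
      rintro ⟨U, hU, h1, h2⟩
      exact ⟨U, (hB U).2 hU, (anc_close hj (hle U hU) (h.nonempty U hU)).1 h1,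
        (anc_close hj (hle Z hZ) (h.nonempty Z hZ)).1 h2⟩

/-! ### Adding and removing a leftmost point -/

theorem not_anc_singleton {Z : Finset (Fin k)} (hZ : ∀ z ∈ Z, j ≤ z) (hne : Z.Nonempty) :
    ¬ Anc S {j} Z := by
  obtain ⟨z, hz⟩ := hne
  rintro (h | ⟨-, h⟩)
  · obtain ⟨i, hi, m, hm, h1, -⟩ := nested_iff.1 h
    rw [Finset.mem_singleton] at hi hm
    grind
  · exact (h z hz j (Finset.mem_singleton_self j)).not_ge (hZ z hz)

theorem anc_left_min {W Z : Finset (Fin k)} (hW : ∀ w ∈ W, j < w) (hj : j ∈ Z) :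
    Anc S W Z ↔ (∃ v, (v, W) ∈ S) ∧ ∀ z ∈ Z, ∀ w ∈ W, z < w := by
  refine or_iff_right ?_
  intro h
  obtain ⟨w, hw, -, -, hlt, -⟩ := h.exists_lt hj
  exact (hW w hw).not_gt hlt

/-- The new relations `Anc` all lead to `{j}` and come from open blocks. For the top of the stack
the edge is assumed; for a lower block, the top lies in between. -/
theorem Good.push (hL : ∀ x ∈ L, j < x) (h : Good G ℓ L C S)
    (hadj : ∀ p ∈ S.head?, G.Adj p.1 (ℓ j)) : Good G ℓ (j :: L) C ((ℓ j, {j}) :: S) := by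
  have hlt : ∀ B, IsBlock C S B → ∀ x ∈ B, j < x := fun B hB x hx => hL x (h.mem hB hx)
  have hne : ∀ B, IsBlock C S B → B ≠ {j} := by
    rintro B hB rfl
    exact lt_irrefl _ (hlt _ hB j (Finset.mem_singleton_self j))
  refine ⟨?_, ?_, ?_, ?_, ?_, ?_, ?_, ?_, ?_, ?_⟩
  · intro B hB
    rcases isBlock_cons.1 hB with rfl | hB
    · simp
    · exact h.nonempty B hB
  · intro x
    rw [List.mem_cons, h.cover x]
    simp only [isBlock_cons]
    constructor
    · rintro (rfl | ⟨B, hB, hx⟩)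
      · exact ⟨{x}, .inl rfl, by simp⟩
      · exact ⟨B, .inr hB, hx⟩
    · rintro ⟨B, rfl | hB, hx⟩
      · exact .inl (by simpa using hx)
      · exact .inr ⟨B, hB, hx⟩
  · intro B B' x hB hB' hx hx'
    rcases isBlock_cons.1 hB with rfl | hB <;> rcases isBlock_cons.1 hB' with rfl | hB'
    · rfl
    · have := hlt _ hB' x hx'
      grind
    · have := hlt _ hB x hx
      grind
    · exact h.disj _ _ _ hB hB' hx hx'
  · intro v X hX hC
    rcases List.mem_cons.1 hX with hX | hX
    · obtain ⟨rfl, rfl⟩ := Prod.mk.inj hX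
      exact hne _ (.inl hC) rfl
    · exact h.sep v X hX hC
  · intro B x y hB hx hy
    rcases isBlock_cons.1 hB with rfl | hB
    · grind
    · exact h.label B x y hB hx hy
  · intro v X x hX hx
    rcases List.mem_cons.1 hX with hX | hX
    · obtain ⟨rfl, rfl⟩ := Prod.mk.inj hX
      grind
    · exact h.stackLabel v X x hX hx
  · refine List.pairwise_cons.2 ⟨?_, h.sorted⟩
    rintro ⟨w, Y⟩ hY x hx y hy
    have := hlt Y (.inr ⟨w, hY⟩) y hy
    grind
  · intro B B' a a' b b' hB hB' ha ha' hb hb' h1 h2 h3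
    rcases isBlock_cons.1 hB with rfl | hB <;> rcases isBlock_cons.1 hB' with rfl | hB'
    · rfl
    · grind
    · grind
    · exact h.ncross _ _ _ _ _ _ hB hB' ha ha' hb hb' h1 h2 h3
  · intro v X Z x z z' hX hZ hx hz hz' h1 h2
    rcases isBlock_cons.1 hZ with rfl | hZ
    · grind
    · rcases List.mem_cons.1 hX with hX | hX
      · obtain ⟨rfl, rfl⟩ := Prod.mk.inj hX
        have := hlt Z hZ z hz
        grind
      · exact h.opened v X Z x z z' hX hZ hx hz hz' h1 h2
  · intro W Z hW hZ hWZ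
    rcases isBlock_cons.1 hW with rfl | hW
    · refine absurd hWZ (not_anc_singleton ?_ ?_)
      · rcases isBlock_cons.1 hZ with rfl | hZ
        · simp
        · exact fun z hz => (hlt Z hZ z hz).le
      · rcases isBlock_cons.1 hZ with rfl | hZ
        · simp
        · exact h.nonempty Z hZ
    · rw [anc_cons_of_ne (hne W hW)] at hWZ
      rcases isBlock_cons.1 hZ with rfl | hZ
      · obtain ⟨⟨w, hw⟩, -⟩ := (anc_left_min (hlt W hW) (Finset.mem_singleton_self j)).1 hWZ
        match S, h, hadj, hw, hlt with
        | (u, U) :: S, h, hadj, hw, hlt =>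
          rcases List.mem_cons.1 hw with hw' | hw'
          · obtain ⟨rfl, rfl⟩ := Prod.mk.inj hw'
            left
            intro y hy z hz
            rw [h.stackLabel w W y hw hy, Finset.mem_singleton.1 hz]
            exact hadj (w, W) rfl
          · right
            have hU : IsBlock C ((u, U) :: S) U := isBlock_cons.2 (.inl rfl)
            refine ⟨U, isBlock_cons.2 (.inr hU), .inr ⟨⟨w, by simp [hw']⟩, ?_⟩,
              .inr ⟨⟨u, by simp⟩, ?_⟩⟩
            · exact (List.pairwise_cons.1 h.sorted).1 _ hw'
            · intro z hz x hx
              rw [Finset.mem_singleton.1 hz]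
              exact hlt U hU x hx
      · refine (h.hom W Z hW hZ hWZ).imp_right ?_
        rintro ⟨U, hU, h1, h2⟩
        exact ⟨U, isBlock_cons.2 (.inr hU), (anc_cons_of_ne (hne W hW)).2 h1,
          (anc_cons_of_ne (hne U hU)).2 h2⟩

/-- The edge from the top `U` to `{j}` is forced because nothing lies between them: an intermediate
`T` would be open, hence below `U` in the stack and to its right, and then it can neither be nested
in `U` nor lie to the left of `U`. -/
theorem Good.of_push (hL : ∀ x ∈ L, j < x) (h : Good G ℓ (j :: L) C ((v, {j}) :: S)) :
    v = ℓ j ∧ Good G ℓ L C S ∧ ∀ p ∈ S.head?, G.Adj p.1 (ℓ j) := by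
  have hold : ∀ B, IsBlock C S B → IsBlock C ((v, {j}) :: S) B := fun B hB => isBlock_cons.2 (.inr hB)
  have hj : IsBlock C ((v, {j}) :: S) {j} := isBlock_cons.2 (.inl rfl)
  have hne : ∀ B, IsBlock C S B → B ≠ {j} := by
    rintro B hB rfl
    exact h.not_isBlock hB
  have hlt : ∀ B, IsBlock C S B → ∀ x ∈ B, j < x := by
    intro B hB x hx
    rcases List.mem_cons.1 (h.mem (hold B hB) hx) with rfl | hx'
    · exact absurd (h.disj _ _ _ (hold B hB) hj hx (by simp)) (hne B hB)
    · exact hL x hx'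
  have hmem : ∀ {p}, p ∈ S → p ∈ (v, {j}) :: S := fun hp => List.mem_cons_of_mem _ hp
  refine ⟨(h.stackLabel v {j} j (by simp) (by simp)).symm,
    ⟨?_, ?_, ?_, ?_, ?_, ?_, ?_, ?_, ?_, ?_⟩, ?_⟩
  · exact fun B hB => h.nonempty B (hold B hB)
  · intro x
    constructor
    · intro hx
      obtain ⟨B, hB, hxB⟩ := (h.cover x).1 (List.mem_cons_of_mem _ hx)
      rcases isBlock_cons.1 hB with rfl | hB
      · have := hL x hx
        grind
      · exact ⟨B, hB, hxB⟩
    · rintro ⟨B, hB, hxB⟩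
      exact (List.mem_cons.1 (h.mem (hold B hB) hxB)).resolve_left (hlt B hB x hxB).ne'
  · exact fun B B' x hB hB' => h.disj B B' x (hold B hB) (hold B' hB')
  · exact fun v X hX => h.sep v X (hmem hX)
  · exact fun B x y hB => h.label B x y (hold B hB)
  · exact fun v X x hX => h.stackLabel v X x (hmem hX)
  · exact (List.pairwise_cons.1 h.sorted).2
  · exact fun B B' a a' b b' hB hB' => h.ncross _ _ _ _ _ _ (hold B hB) (hold B' hB')
  · exact fun v X Z x z z' hX hZ => h.opened v X Z x z z' (hmem hX) (hold Z hZ)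
  · intro W Z hW hZ hWZ
    refine (h.hom W Z (hold W hW) (hold Z hZ) ((anc_cons_of_ne (hne W hW)).2 hWZ)).imp_right ?_
    rintro ⟨U, hU, h1, h2⟩
    rcases isBlock_cons.1 hU with rfl | hU
    · exact absurd h2 (not_anc_singleton (fun z hz => (hlt Z hZ z hz).le)
        (h.nonempty Z (hold Z hZ)))
    · exact ⟨U, hU, (anc_cons_of_ne (hne W hW)).1 h1, (anc_cons_of_ne (hne U hU)).1 h2⟩
  · rintro ⟨w, W⟩ hp
    match S, h, hp, hlt, hold, hne, hj with
    | (u, U) :: S, h, hp, hlt, hold, hne, hj =>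
      obtain ⟨rfl, rfl⟩ := Prod.mk.inj (Option.some.inj hp)
      have hU : IsBlock C ((u, U) :: S) U := isBlock_cons.2 (.inl rfl)
      obtain ⟨x, hx⟩ := h.nonempty U (hold U hU)
      have hU' : (u, U) ∈ (v, {j}) :: (u, U) :: S := by simp
      have hanc : Anc ((v, {j}) :: (u, U) :: S) U {j} := by
        refine .inr ⟨⟨u, hU'⟩, fun z hz y hy => ?_⟩
        rw [Finset.mem_singleton.1 hz]
        exact hlt U hU y hy
      rcases h.hom U {j} (hold U hU) hj hanc with h1 | ⟨T, hT, h1, h2⟩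
      · rw [← h.stackLabel u U x hU' hx]
        exact h1 x hx j (by simp)
      · exfalso
        rcases isBlock_cons.1 hT with rfl | hT
        · exact not_anc_singleton (by simp) (by simp) h2
        · obtain ⟨⟨t, ht⟩, -⟩ := (anc_left_min (hlt T hT) (Finset.mem_singleton_self j)).1 h2
          rcases List.mem_cons.1 ht with ht | ht
          · exact hne T hT (Prod.mk.inj ht).2
          rcases h1 with hn | ⟨-, hlt'⟩
          · obtain ⟨z, hz⟩ := h.nonempty T (hold T hT)
            obtain ⟨a, ha, b, hb, haz, hzb⟩ := hn.exists_lt hz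
            have := h.opened t T U z a b (List.mem_cons_of_mem _ ht) (hold U hU) hz ha hb haz hzb
            subst this
            exact not_nested_self hn
          · obtain ⟨z, hz⟩ := h.nonempty T (hold T hT)
            rcases List.mem_cons.1 ht with ht | ht
            · obtain ⟨rfl, rfl⟩ := Prod.mk.inj ht
              exact lt_irrefl _ (hlt' x hx x hx)
            · exact lt_asymm (hlt' z hz x hx) ((List.pairwise_cons.1
                (List.pairwise_cons.1 h.sorted).2).1 _ ht x hx z hz)

/-- `Anc` does not change when the open block grows: the gap created by `j` turns exactly the
anticipated nestings into actual ones, by `nested_insert`. -/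
theorem anc_extend_left (hX : ∀ x ∈ X, j < x) (hne : X.Nonempty) {Z : Finset (Fin k)}
    (hZ : ∀ z ∈ Z, j < z) (hZne : Z.Nonempty) :
    Anc ((v, insert j X) :: S) (insert j X) Z ↔ Anc ((v, X) :: S) X Z := by
  have h1 : ¬ ∀ z ∈ Z, ∀ w ∈ insert j X, z < w := fun h => by
    obtain ⟨z, hz⟩ := hZne
    exact lt_asymm (hZ z hz) (h z hz j (Finset.mem_insert_self _ _))
  have h2 : ∃ w, (w, X) ∈ (v, X) :: S := ⟨v, by simp⟩
  rw [Anc, Anc, nested_insert hX hne hZ]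
  tauto

/-- Relations out of `X` are transported by `anc_extend_left`. Relations into `X` come only from
open blocks to the right of `X`, and these are also to the right of `insert j X`. -/
theorem Good.extend (hL : ∀ x ∈ L, j < x) (h : Good G ℓ L C ((ℓ j, X) :: S)) :
    Good G ℓ (j :: L) C ((ℓ j, insert j X) :: S) := by
  have hX : IsBlock C ((ℓ j, X) :: S) X := isBlock_cons.2 (.inl rfl)
  have hXne : X.Nonempty := h.nonempty X hX
  have hold : ∀ B, IsBlock C S B → IsBlock C ((ℓ j, X) :: S) B := fun B hB => isBlock_cons.2 (.inr hB)
  have hlt : ∀ B, IsBlock C ((ℓ j, X) :: S) B → ∀ x ∈ B, j < x :=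
    fun B hB x hx => hL x (h.mem hB hx)
  have hne : ∀ B, IsBlock C S B → B ≠ X := by
    rintro B hB rfl
    exact h.not_isBlock hB
  have hne' : ∀ B, IsBlock C S B → B ≠ insert j X := by
    rintro B hB rfl
    exact lt_irrefl _ (hlt _ (hold _ hB) j (Finset.mem_insert_self _ _))
  have hdisj : ∀ B, IsBlock C S B → ∀ x ∈ B, x ∉ X := fun B hB x hx hxX =>
    hne B hB (h.disj _ _ _ (hold B hB) hX hx hxX)
  have hmem : ∀ {p}, p ∈ S → p ∈ (ℓ j, X) :: S := fun hp => List.mem_cons_of_mem _ hp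
  have hXlab : ∀ x ∈ insert j X, ℓ x = ℓ j := by
    intro x hx
    rcases Finset.mem_insert.1 hx with rfl | hx
    · rfl
    · exact h.stackLabel _ X x List.mem_cons_self hx
  refine ⟨?_, ?_, ?_, ?_, ?_, ?_, ?_, ?_, ?_, ?_⟩
  · intro B gB
    rcases isBlock_cons.1 gB with rfl | hB
    · simp
    · exact h.nonempty B (hold B hB)
  · intro x
    rw [List.mem_cons, h.cover x]
    simp only [isBlock_cons]
    constructor
    · rintro (rfl | ⟨B, rfl | hB, hx⟩)
      · exact ⟨_, .inl rfl, by simp⟩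
      · exact ⟨_, .inl rfl, Finset.mem_insert_of_mem hx⟩
      · exact ⟨B, .inr hB, hx⟩
    · rintro ⟨B, rfl | hB, hx⟩
      · rcases Finset.mem_insert.1 hx with rfl | hx
        · exact .inl rfl
        · exact .inr ⟨X, .inl rfl, hx⟩
      · exact .inr ⟨B, .inr hB, hx⟩
  · intro B B' x gB gB' hx hx'
    rcases isBlock_cons.1 gB with rfl | hB <;> rcases isBlock_cons.1 gB' with rfl | hB'
    · rfl
    · have := hlt _ (hold _ hB') x hx'
      have := hdisj _ hB' x hx'
      grind
    · have := hlt _ (hold _ hB) x hx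
      have := hdisj _ hB x hx
      grind
    · exact h.disj _ _ _ (hold _ hB) (hold _ hB') hx hx'
  · intro v Y hY hC
    rcases List.mem_cons.1 hY with hY | hY
    · obtain ⟨rfl, rfl⟩ := Prod.mk.inj hY
      exact hne' _ (.inl hC) rfl
    · exact h.sep v Y (hmem hY) hC
  · intro B x y gB hx hy
    rcases isBlock_cons.1 gB with rfl | hB
    · rw [hXlab x hx, hXlab y hy]
    · exact h.label B x y (hold B hB) hx hy
  · intro v Y x hY hx
    rcases List.mem_cons.1 hY with hY | hY
    · obtain ⟨rfl, rfl⟩ := Prod.mk.inj hY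
      exact hXlab x hx
    · exact h.stackLabel v Y x (hmem hY) hx
  · refine List.pairwise_cons.2 ⟨?_, (List.pairwise_cons.1 h.sorted).2⟩
    rintro ⟨w, Y⟩ hY x hx y hy
    rcases Finset.mem_insert.1 hx with rfl | hx
    · exact hlt Y (.inr ⟨w, hmem hY⟩) y hy
    · exact (List.pairwise_cons.1 h.sorted).1 _ hY x hx y hy
  · intro B B' a a' b b' gB gB' ha ha' hb hb' h1 h2 h3
    rcases isBlock_cons.1 gB with rfl | hB <;> rcases isBlock_cons.1 gB' with rfl | hB'
    · rfl
    · have ha'j := hlt _ (hold _ hB') a' ha'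
      have hbX : b ∈ X := by grind
      exact absurd (h.opened _ X B' b a' b' List.mem_cons_self (hold _ hB') hbX ha' hb' h2 h3) (hne _ hB')
    · have haj := hlt _ (hold _ hB) a ha
      have h4 : a' ∈ X := by grind
      have h5 : b' ∈ X := by grind
      exact absurd (h.ncross _ _ _ _ _ _ (hold _ hB) hX ha h4 hb h5 h1 h2 h3) (hne _ hB)
    · exact h.ncross _ _ _ _ _ _ (hold _ hB) (hold _ hB') ha ha' hb hb' h1 h2 h3
  · intro v Y Z x z z' hY gZ hx hz hz' h1 h2
    rcases isBlock_cons.1 gZ with rfl | hZ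
    · rcases List.mem_cons.1 hY with hY | hY
      · obtain ⟨rfl, rfl⟩ := Prod.mk.inj hY
        rfl
      · exfalso
        have h3 := hlt Y (.inr ⟨v, hmem hY⟩) x hx
        have h4 : z' ∈ X := by grind
        exact lt_asymm h2 ((List.pairwise_cons.1 h.sorted).1 _ hY z' h4 x hx)
    · rcases List.mem_cons.1 hY with hY | hY
      · obtain ⟨rfl, rfl⟩ := Prod.mk.inj hY
        have h3 := hlt Z (hold _ hZ) z hz
        have h4 : x ∈ X := by grind
        exact absurd (h.opened _ X Z x z z' List.mem_cons_self (hold _ hZ) h4 hz hz' h1 h2) (hne Z hZ)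
      · exact h.opened v Y Z x z z' (hmem hY) (hold _ hZ) hx hz hz' h1 h2
  · intro W Z gW gZ hWZ
    rcases isBlock_cons.1 gW with rfl | hW <;> rcases isBlock_cons.1 gZ with rfl | hZ
    · exfalso
      rcases hWZ with hn | ⟨-, hlt⟩
      · exact not_nested_self hn
      · exact lt_irrefl j (hlt j (by simp) j (by simp))
    · have hZne := h.nonempty Z (hold Z hZ)
      rw [anc_extend_left (hlt X hX) hXne (hlt Z (hold Z hZ)) hZne] at hWZ
      rcases h.hom X Z hX (hold Z hZ) hWZ with h1 | ⟨U, gU, h1, h2⟩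
      · left
        intro w hw z hz
        obtain ⟨x, hx⟩ := hXne
        rw [hXlab w hw, ← h.stackLabel _ X x List.mem_cons_self hx]
        exact h1 x hx z hz
      · right
        rcases isBlock_cons.1 gU with rfl | hU
        · exfalso
          obtain ⟨x, hx⟩ := hXne
          rcases h1 with hn | ⟨-, hlt⟩
          · exact not_nested_self hn
          · exact lt_irrefl x (hlt x hx x hx)
        · refine ⟨U, isBlock_cons.2 (.inr hU), ?_, ?_⟩
          · exact (anc_extend_left (hlt X hX) hXne (hlt U (hold U hU))
              (h.nonempty U (hold U hU))).2 h1
          · rw [anc_cons_of_ne (hne U hU)] at h2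
            rwa [anc_cons_of_ne (hne' U hU)]
    · obtain ⟨⟨w, hw⟩, hWlt⟩ := (anc_left_min (hlt W (hold W hW)) (Finset.mem_insert_self j X)).1 hWZ
      have hw' : (w, W) ∈ S := by
        rcases List.mem_cons.1 hw with hw | hw
        · exact absurd (Prod.mk.inj hw).2 (hne' W hW)
        · exact hw
      have hanc : Anc ((ℓ j, X) :: S) W X :=
        .inr ⟨⟨w, hmem hw'⟩, fun z hz => hWlt z (Finset.mem_insert_of_mem hz)⟩
      rcases h.hom W X (hold W hW) hX hanc with h1 | ⟨U, gU, h1, h2⟩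
      · left
        intro y hy z hz
        obtain ⟨x, hx⟩ := hXne
        rw [hXlab z hz, ← h.stackLabel _ X x List.mem_cons_self hx]
        exact h1 y hy x hx
      · right
        rcases isBlock_cons.1 gU with rfl | hU
        · exfalso
          obtain ⟨x, hx⟩ := hXne
          rcases h2 with hn | ⟨-, hlt⟩
          · exact not_nested_self hn
          · exact lt_irrefl x (hlt x hx x hx)
        · refine ⟨U, isBlock_cons.2 (.inr hU), ?_, ?_⟩
          · rwa [anc_cons_of_ne (hne' W hW), ← anc_cons_of_ne (hne W hW)]
          · rw [anc_cons_of_ne (hne U hU)] at h2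
            rw [anc_cons_of_ne (hne' U hU)]
            refine (anc_left_min (hlt U (hold U hU)) (Finset.mem_insert_self j X)).2 ?_
            -- An open block is not yet nested in another one, by `opened`.
            rcases h2 with hn | ⟨⟨u, hu⟩, hUlt⟩
            · exfalso
              obtain ⟨x, hx⟩ := hXne
              obtain ⟨a, ha, b, hb, hax, hxb⟩ := hn.exists_lt hx
              exact hne U hU (h.opened _ X U x a b List.mem_cons_self (hold U hU) hx ha hb hax hxb)
            · refine ⟨⟨u, hu⟩, fun z hz y hy => ?_⟩
              rcases Finset.mem_insert.1 hz with rfl | hz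
              · exact hlt U (hold U hU) y hy
              · exact hUlt z hz y hy
    · rw [anc_cons_of_ne (hne' W hW), ← anc_cons_of_ne (hne W hW)] at hWZ
      refine (h.hom W Z (hold W hW) (hold Z hZ) hWZ).imp_right ?_
      rintro ⟨U, gU, h1, h2⟩
      rcases isBlock_cons.1 gU with rfl | hU
      · refine ⟨_, isBlock_cons.2 (.inl rfl), ?_, ?_⟩
        · rw [anc_cons_of_ne (hne W hW)] at h1
          rw [anc_cons_of_ne (hne' W hW)]
          refine (anc_left_min (hlt W (hold W hW)) (Finset.mem_insert_self j _)).2 ?_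
          rcases h1 with hn | ⟨⟨u, hu⟩, hUlt⟩
          · exfalso
            obtain ⟨x, hx⟩ := hXne
            obtain ⟨a, ha, b, hb, hax, hxb⟩ := hn.exists_lt hx
            exact hne W hW (h.opened _ _ W x a b List.mem_cons_self (hold W hW) hx ha hb hax hxb)
          · refine ⟨⟨u, hu⟩, fun z hz y hy => ?_⟩
            rcases Finset.mem_insert.1 hz with rfl | hz
            · exact hlt W (hold W hW) y hy
            · exact hUlt z hz y hy
        · exact (anc_extend_left (hlt _ hX) hXne (hlt Z (hold Z hZ))
            (h.nonempty Z (hold Z hZ))).2 h2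
      · refine ⟨U, isBlock_cons.2 (.inr hU), ?_, ?_⟩
        · rwa [anc_cons_of_ne (hne' W hW), ← anc_cons_of_ne (hne W hW)]
        · rwa [anc_cons_of_ne (hne' U hU), ← anc_cons_of_ne (hne U hU)]

theorem Good.of_extend (hL : ∀ x ∈ L, j < x) (hXne : X.Nonempty) (hjX : j ∉ X)
    (h : Good G ℓ (j :: L) C ((v, insert j X) :: S)) : v = ℓ j ∧ Good G ℓ L C ((v, X) :: S) := by
  set X' := insert j X with hX'
  have hsub : ∀ x ∈ X, x ∈ X' := fun x hx => Finset.mem_insert_of_mem hx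
  have hjX' : j ∈ X' := Finset.mem_insert_self j X
  have hX : IsBlock C ((v, X') :: S) X' := isBlock_cons.2 (.inl rfl)
  have hold : ∀ B, IsBlock C S B → IsBlock C ((v, X') :: S) B := fun B hB => isBlock_cons.2 (.inr hB)
  have hne' : ∀ B, IsBlock C S B → B ≠ X' := by
    rintro B hB rfl
    exact h.not_isBlock hB
  have hdisj : ∀ B, IsBlock C S B → ∀ x ∈ B, x ∉ X' := fun B hB x hx hxX =>
    hne' B hB (h.disj _ _ _ (hold B hB) hX hx hxX)
  have hXlt : ∀ x ∈ X, j < x := by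
    intro x hx
    rcases List.mem_cons.1 (h.mem hX (hsub x hx)) with rfl | hx'
    · exact absurd hx hjX
    · exact hL x hx'
  have hlt : ∀ B, IsBlock C S B → ∀ x ∈ B, j < x := by
    intro B hB x hx
    rcases List.mem_cons.1 (h.mem (hold B hB) hx) with rfl | hx'
    · exact absurd hjX' (hdisj B hB _ hx)
    · exact hL x hx'
  have hne : ∀ B, IsBlock C S B → B ≠ X := by
    rintro B hB rfl
    obtain ⟨x, hx⟩ := hXne
    exact hdisj _ hB x hx (hsub x hx)
  have hmem : ∀ {p}, p ∈ S → p ∈ (v, X') :: S := fun hp => List.mem_cons_of_mem _ hp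
  have hvj : ℓ j = v := h.stackLabel v X' j List.mem_cons_self hjX'
  refine ⟨hvj.symm, ⟨?_, ?_, ?_, ?_, ?_, ?_, ?_, ?_, ?_, ?_⟩⟩
  · intro B gB
    rcases isBlock_cons.1 gB with rfl | hB
    · exact hXne
    · exact h.nonempty B (hold B hB)
  · intro x
    simp only [isBlock_cons]
    constructor
    · intro hx
      obtain ⟨B, gB, hxB⟩ := (h.cover x).1 (List.mem_cons_of_mem _ hx)
      rcases isBlock_cons.1 gB with rfl | hB
      · exact ⟨X, .inl rfl, (Finset.mem_insert.1 hxB).resolve_left (hL x hx).ne'⟩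
      · exact ⟨B, .inr hB, hxB⟩
    · rintro ⟨B, rfl | hB, hx⟩
      · exact (List.mem_cons.1 (h.mem hX (hsub x hx))).resolve_left (hXlt x hx).ne'
      · exact (List.mem_cons.1 (h.mem (hold B hB) hx)).resolve_left (hlt B hB x hx).ne'
  · intro B B' x gB gB' hx hx'
    rcases isBlock_cons.1 gB with rfl | hB <;> rcases isBlock_cons.1 gB' with rfl | hB'
    · rfl
    · exact absurd (hsub x hx) (hdisj _ hB' x hx')
    · exact absurd (hsub x hx') (hdisj _ hB x hx)
    · exact h.disj _ _ _ (hold _ hB) (hold _ hB') hx hx'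
  · intro v Y hY hC
    rcases List.mem_cons.1 hY with hY | hY
    · obtain ⟨rfl, rfl⟩ := Prod.mk.inj hY
      exact hne _ (.inl hC) rfl
    · exact h.sep v Y (hmem hY) hC
  · intro B x y gB hx hy
    rcases isBlock_cons.1 gB with rfl | hB
    · exact h.label X' x y hX (hsub x hx) (hsub y hy)
    · exact h.label B x y (hold B hB) hx hy
  · intro w Y x hY hx
    rcases List.mem_cons.1 hY with hY | hY
    · obtain ⟨rfl, rfl⟩ := Prod.mk.inj hY
      exact h.stackLabel w X' x List.mem_cons_self (hsub x hx)
    · exact h.stackLabel w Y x (hmem hY) hx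
  · exact List.pairwise_cons.2 ⟨fun p hp x hx => (List.pairwise_cons.1 h.sorted).1 p hp x (hsub x hx),
      (List.pairwise_cons.1 h.sorted).2⟩
  · intro B B' a a' b b' gB gB' ha ha' hb hb' h1 h2 h3
    rcases isBlock_cons.1 gB with rfl | hB <;> rcases isBlock_cons.1 gB' with rfl | hB'
    · rfl
    · exact absurd (h.ncross _ _ _ _ _ _ hX (hold _ hB') (hsub _ ha) ha' (hsub _ hb) hb' h1 h2 h3).symm
        (hne' _ hB')
    · exact absurd (h.ncross _ _ _ _ _ _ (hold _ hB) hX ha (hsub _ ha') hb (hsub _ hb') h1 h2 h3)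
        (hne' _ hB)
    · exact h.ncross _ _ _ _ _ _ (hold _ hB) (hold _ hB') ha ha' hb hb' h1 h2 h3
  · intro w Y Z x z z' hY gZ hx hz hz' h1 h2
    rcases isBlock_cons.1 gZ with rfl | hZ <;> rcases List.mem_cons.1 hY with hY | hY
    · exact (Prod.mk.inj hY).2.symm
    · exact absurd (h.opened w Y X' x z z' (hmem hY) hX hx (hsub _ hz) (hsub _ hz') h1 h2).symm
        (hne' Y (.inr ⟨w, hY⟩))
    · obtain ⟨rfl, rfl⟩ := Prod.mk.inj hY
      exact absurd (h.opened w X' Z x z z' List.mem_cons_self (hold _ hZ) (hsub _ hx) hz hz' h1 h2) (hne' Z hZ)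
    · exact h.opened w Y Z x z z' (hmem hY) (hold _ hZ) hx hz hz' h1 h2
  -- A block lying to the right of `j` can be an ancestor of `X'` only by being open, and then it is
  -- to the right of `X` as well.
  · have key : ∀ U, IsBlock C S U → Anc ((v, X') :: S) U X' → Anc ((v, X) :: S) U X := by
      intro U hU hanc
      rw [anc_cons_of_ne (hne' U hU)] at hanc
      rw [anc_cons_of_ne (hne U hU)]
      obtain ⟨hu, hUlt⟩ := (anc_left_min (hlt U hU) hjX').1 hanc
      exact .inr ⟨hu, fun z hz => hUlt z (hsub z hz)⟩
    intro W Z gW gZ hWZ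
    rcases isBlock_cons.1 gW with rfl | hW <;> rcases isBlock_cons.1 gZ with rfl | hZ
    · exfalso
      obtain ⟨x, hx⟩ := hXne
      rcases hWZ with hn | ⟨-, hlt⟩
      · exact not_nested_self hn
      · exact lt_irrefl x (hlt x hx x hx)
    · have hZne := h.nonempty Z (hold Z hZ)
      rw [← anc_extend_left hXlt hXne (hlt Z hZ) hZne] at hWZ
      rcases h.hom X' Z hX (hold Z hZ) hWZ with h1 | ⟨U, gU, h1, h2⟩
      · exact .inl fun w hw => h1 w (hsub w hw)
      · right
        rcases isBlock_cons.1 gU with rfl | hU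
        · exfalso
          rcases h1 with hn | ⟨-, hlt⟩
          · exact not_nested_self hn
          · exact lt_irrefl j (hlt j hjX' j hjX')
        · refine ⟨U, isBlock_cons.2 (.inr hU), ?_, ?_⟩
          · exact (anc_extend_left hXlt hXne (hlt U hU) (h.nonempty U (hold U hU))).1 h1
          · rw [anc_cons_of_ne (hne' U hU)] at h2
            rwa [anc_cons_of_ne (hne U hU)]
    · have hanc : Anc ((v, X') :: S) W X' := by
        rw [anc_cons_of_ne (hne' W hW)]
        rw [anc_cons_of_ne (hne W hW)] at hWZ
        rcases hWZ with hn | ⟨hu, hWlt⟩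
        · exfalso
          obtain ⟨x, hx⟩ := hXne
          obtain ⟨a, ha, b, hb, hax, hxb⟩ := hn.exists_lt hx
          exact hne' W hW (h.opened _ X' W x a b List.mem_cons_self (hold W hW) (hsub x hx)
            ha hb hax hxb)
        · refine .inr ⟨hu, fun z hz y hy => ?_⟩
          rcases Finset.mem_insert.1 hz with rfl | hz
          · exact hlt W hW y hy
          · exact hWlt z hz y hy
      rcases h.hom W X' (hold W hW) hX hanc with h1 | ⟨U, gU, h1, h2⟩
      · exact .inl fun w hw z hz => h1 w hw z (hsub z hz)
      · right
        rcases isBlock_cons.1 gU with rfl | hU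
        · exfalso
          rcases h2 with hn | ⟨-, hlt⟩
          · exact not_nested_self hn
          · exact lt_irrefl j (hlt j hjX' j hjX')
        · refine ⟨U, isBlock_cons.2 (.inr hU), ?_, key U hU h2⟩
          rwa [anc_cons_of_ne (hne W hW), ← anc_cons_of_ne (hne' W hW)]
    · rw [anc_cons_of_ne (hne W hW), ← anc_cons_of_ne (hne' W hW)] at hWZ
      refine (h.hom W Z (hold W hW) (hold Z hZ) hWZ).imp_right ?_
      rintro ⟨U, gU, h1, h2⟩
      rcases isBlock_cons.1 gU with rfl | hU
      · exact ⟨X, isBlock_cons.2 (.inl rfl), key W hW h1,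
          (anc_extend_left hXlt hXne (hlt Z hZ) (h.nonempty Z (hold Z hZ))).1 h2⟩
      · refine ⟨U, isBlock_cons.2 (.inr hU), ?_, ?_⟩
        · rwa [anc_cons_of_ne (hne W hW), ← anc_cons_of_ne (hne' W hW)]
        · rwa [anc_cons_of_ne (hne U hU), ← anc_cons_of_ne (hne' U hU)]

end States

/-! ### Runs of the stack machine and NC_k(ℓ, G) -/

section Enumeration

variable {k : ℕ} {V : Type*}

variable (k V) in
/-- The closed blocks and the labelled stack of open blocks of a partially built partition. -/
abbrev BlockState : Type _ := Finset (Finset (Fin k)) × List (V × Finset (Fin k))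

/-- The block `X`, which has just received an element, is closed or stays open. -/
def closeOrKeep (C : Finset (Finset (Fin k))) (v : V) (X : Finset (Fin k))
    (S : List (V × Finset (Fin k))) : List (BlockState k V) :=
  [(insert X C, S), (C, (v, X) :: S)]

open Classical in
/-- The ways of adding a point `j` on the left of a partially built partition. -/
def step (G : Digraph V) (ℓ : Fin k → V) (j : Fin k) : BlockState k V → List (BlockState k V)
  | (C, []) => closeOrKeep C (ℓ j) {j} []
  | (C, (v, X) :: S) =>
    if v = ℓ j then closeOrKeep C v (insert j X) S
    else if G.Adj v (ℓ j) then closeOrKeep C (ℓ j) {j} ((v, X) :: S)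
    else []

/-- The partially built partitions of the points of a list, which is read from right to left. -/
def states (G : Digraph V) (ℓ : Fin k → V) : List (Fin k) → List (BlockState k V)
  | [] => [(∅, [])]
  | j :: L => (states G ℓ L).flatMap (step G ℓ j)

/-- `X'` is the block that contains `j` after `j` has been added to the stack `S`, and `S'` is the
rest of the stack. -/
def Touch (G : Digraph V) (ℓ : Fin k → V) (j : Fin k) (S : List (V × Finset (Fin k)))
    (X' : Finset (Fin k)) (S' : List (V × Finset (Fin k))) : Prop :=
  (X' = {j} ∧ S' = S ∧ ∀ p ∈ S.head?, G.Adj p.1 (ℓ j)) ∨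
    ∃ X, S = (ℓ j, X) :: S' ∧ X' = insert j X

variable {G : Digraph V} {ℓ : Fin k → V} {L : List (Fin k)} {C : Finset (Finset (Fin k))}
  {S : List (V × Finset (Fin k))} {j : Fin k}

theorem Touch.mem {X' : Finset (Fin k)} {S' : List (V × Finset (Fin k))}
    (h : Touch G ℓ j S X' S') : j ∈ X' := by
  rcases h with ⟨rfl, -⟩ | ⟨X, -, rfl⟩ <;> simp

/-- Without loops the alternatives of `Touch` exclude each other: pushing onto a block with label `ℓ
j` would need an edge from `ℓ j` to itself. The case distinction in `step` thus loses nothing. -/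
theorem mem_step (hG : ∀ v, ¬ G.Adj v v) {s : BlockState k V} : s ∈ step G ℓ j (C, S) ↔
    ∃ X' S', Touch G ℓ j S X' S' ∧ (s = (insert X' C, S') ∨ s = (C, (ℓ j, X') :: S')) := by
  match S with
  | [] => simp [step, closeOrKeep, Touch]
  | (v, X) :: S =>
    by_cases h1 : v = ℓ j
    · subst h1
      simp [step, closeOrKeep, Touch, hG]
    · by_cases h2 : G.Adj v (ℓ j)
      · simp [step, closeOrKeep, Touch, h1, h2]
      · simp [step, Touch, h1, h2]

theorem Good.of_mem_step (hG : ∀ v, ¬ G.Adj v v) (hL : ∀ x ∈ L, j < x) (h : Good G ℓ L C S)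
    {s : BlockState k V} (hs : s ∈ step G ℓ j (C, S)) : Good G ℓ (j :: L) s.1 s.2 := by
  obtain ⟨X', S', hT, hs⟩ := (mem_step hG).1 hs
  have key : Good G ℓ (j :: L) C ((ℓ j, X') :: S') := by
    rcases hT with ⟨rfl, rfl, hadj⟩ | ⟨X, rfl, rfl⟩
    · exact h.push hL hadj
    · exact h.extend hL
  rcases hs with rfl | rfl
  · refine ((good_close_iff hT.mem ?_ (key.sep _ _ List.mem_cons_self)).2 key).1
    intro x hx
    rcases List.mem_cons.1 hx with rfl | hx
    exacts [le_rfl, (hL x hx).le]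
  · exact key

/-- The last move was a push if the block of `j` is a singleton and an extension otherwise. -/
theorem Good.exists_touch (hL : ∀ x ∈ L, j < x) {X' : Finset (Fin k)}
    {S' : List (V × Finset (Fin k))} (hj : j ∈ X') (h : Good G ℓ (j :: L) C ((ℓ j, X') :: S')) :
    ∃ S, Touch G ℓ j S X' S' ∧ Good G ℓ L C S := by
  by_cases hX : X' = {j}
  · subst hX
    obtain ⟨-, h1, h2⟩ := h.of_push hL
    exact ⟨S', .inl ⟨rfl, rfl, h2⟩, h1⟩
  · have hne : (X'.erase j).Nonempty := by
      by_contra hne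
      rw [Finset.not_nonempty_iff_eq_empty, Finset.erase_eq_empty_iff] at hne
      rcases hne with rfl | hne
      · simp at hj
      · exact hX hne
    rw [← Finset.insert_erase hj] at h
    exact ⟨_, .inr ⟨X'.erase j, rfl, (Finset.insert_erase hj).symm⟩,
      (h.of_extend hL hne (by simp)).2⟩

theorem Good.exists_mem_step (hG : ∀ v, ¬ G.Adj v v) (hL : ∀ x ∈ L, j < x) {s : BlockState k V}
    (h : Good G ℓ (j :: L) s.1 s.2) :
    ∃ t : BlockState k V, Good G ℓ L t.1 t.2 ∧ s ∈ step G ℓ j t := by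
  obtain ⟨C, S⟩ := s
  have hle : ∀ x ∈ j :: L, j ≤ x := by
    intro x hx
    rcases List.mem_cons.1 hx with rfl | hx
    exacts [le_rfl, (hL x hx).le]
  obtain ⟨X', hX', hj⟩ := (h.cover j).1 List.mem_cons_self
  by_cases hC : X' ∈ C
  · have hS : ∀ v, (v, X') ∉ S := fun v hv => h.sep v X' hv hC
    dsimp only at h
    rw [← Finset.insert_erase hC] at h
    obtain ⟨S', hT, hS'⟩ := ((good_close_iff hj hle (by simp)).1 ⟨h, hS⟩).exists_touch hL hj
    exact ⟨(C.erase X', S'), hS', (mem_step hG).2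
      ⟨X', S, hT, .inl (by rw [Finset.insert_erase hC])⟩⟩
  · obtain ⟨v, hv⟩ := hX'.resolve_left hC
    match S, h, hv with
    | (w, Y) :: S, h, hv =>
      rcases List.mem_cons.1 hv with hv | hv
      · obtain ⟨rfl, rfl⟩ := Prod.mk.inj hv
        obtain rfl : ℓ j = v := h.stackLabel v X' j List.mem_cons_self hj
        obtain ⟨S', hT, hS'⟩ := h.exists_touch hL hj
        exact ⟨(C, S'), hS', (mem_step hG).2 ⟨X', S, hT, .inr rfl⟩⟩
      -- Below the top of the stack, `sorted` would put `j` to the right of a point of the top block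
      -- `Y`.
      · exfalso
        have hY : IsBlock C ((w, Y) :: S) Y := isBlock_cons.2 (.inl rfl)
        obtain ⟨y, hy⟩ := h.nonempty Y hY
        exact (hle y (h.mem hY hy)).not_gt ((List.pairwise_cons.1 h.sorted).1 _ hv y hy j hj)

theorem good_nil {s : BlockState k V} : Good G ℓ [] s.1 s.2 ↔ s = (∅, []) := by
  obtain ⟨C, S⟩ := s
  constructor
  · intro h
    have hB : ∀ B, ¬ IsBlock C S B := by
      intro B hB
      obtain ⟨x, hx⟩ := h.nonempty B hB
      exact List.not_mem_nil (h.mem hB hx)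
    have hC : C = ∅ := Finset.eq_empty_of_forall_notMem fun B hC => hB B (.inl hC)
    have hS : S = [] := List.eq_nil_iff_forall_not_mem.2 fun p hp => hB p.2 (.inr ⟨p.1, hp⟩)
    rw [hC, hS]
  · rintro h
    obtain ⟨rfl, rfl⟩ := Prod.mk.inj h
    have hB : ∀ B, ¬ IsBlock (∅ : Finset (Finset (Fin k))) ([] : List (V × Finset (Fin k))) B := by
      simp [IsBlock]
    refine ⟨?_, ?_, ?_, ?_, ?_, ?_, ?_, ?_, ?_, ?_⟩ <;> simp [hB]

/-- The conditions in `Good` are exact: each move preserves them, and every good state with a point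
to remove has a good predecessor. -/
theorem mem_states (hG : ∀ v, ¬ G.Adj v v) (hL : L.Pairwise (· < ·)) {s : BlockState k V} :
    s ∈ states G ℓ L ↔ Good G ℓ L s.1 s.2 := by
  induction L generalizing s with
  | nil => rw [good_nil, states, List.mem_singleton]
  | cons j L ih =>
    obtain ⟨hj, hL⟩ := List.pairwise_cons.1 hL
    rw [states, List.mem_flatMap]
    constructor
    · rintro ⟨t, ht, hs⟩
      exact ((ih hL).1 ht).of_mem_step hG hj hs
    · intro h
      obtain ⟨t, ht, hs⟩ := h.exists_mem_step hG hj
      exact ⟨t, (ih hL).2 ht, hs⟩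

theorem Touch.unique {X' : Finset (Fin k)} {S₁ S₂ S' : List (V × Finset (Fin k))}
    (h₁ : Touch G ℓ j S₁ X' S') (h₂ : Touch G ℓ j S₂ X' S')
    (g₁ : ∀ p ∈ S₁, p.2.Nonempty ∧ j ∉ p.2) (g₂ : ∀ p ∈ S₂, p.2.Nonempty ∧ j ∉ p.2) : S₁ = S₂ := by
  rcases h₁ with ⟨rfl, rfl, -⟩ | ⟨X, rfl, rfl⟩ <;> rcases h₂ with ⟨h, h', -⟩ | ⟨Y, rfl, h⟩
  · exact h'
  · obtain ⟨⟨y, hy⟩, hj⟩ := g₂ _ List.mem_cons_self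
    have : y ∈ ({j} : Finset (Fin k)) := h ▸ Finset.mem_insert_of_mem hy
    rw [Finset.mem_singleton] at this
    exact absurd (this ▸ hy) hj
  · obtain ⟨⟨y, hy⟩, hj⟩ := g₁ _ List.mem_cons_self
    have : y ∈ ({j} : Finset (Fin k)) := h ▸ Finset.mem_insert_of_mem hy
    rw [Finset.mem_singleton] at this
    exact absurd (this ▸ hy) hj
  · have h1 : j ∉ X := (g₁ _ List.mem_cons_self).2
    have h2 : j ∉ Y := (g₂ _ List.mem_cons_self).2
    rw [← Finset.erase_insert h1, h, Finset.erase_insert h2]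

/-- The block containing `j` in `s`, together with its being closed or open, determines the move; no
block of a predecessor contains `j`. -/
theorem step_injective (hG : ∀ v, ¬ G.Adj v v) (hL : ∀ x ∈ L, j < x) {s s₁ s₂ : BlockState k V}
    (g₁ : Good G ℓ L s₁.1 s₁.2) (g₂ : Good G ℓ L s₂.1 s₂.2) (h₁ : s ∈ step G ℓ j s₁)
    (h₂ : s ∈ step G ℓ j s₂) : s₁ = s₂ := by
  obtain ⟨C₁, S₁⟩ := s₁
  obtain ⟨C₂, S₂⟩ := s₂
  obtain ⟨X₁, T₁, t₁, h₁⟩ := (mem_step hG).1 h₁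
  obtain ⟨X₂, T₂, t₂, h₂⟩ := (mem_step hG).1 h₂
  dsimp only at g₁ g₂
  have k₁ : ∀ B, IsBlock C₁ S₁ B → j ∉ B := fun B hB h => lt_irrefl _ (hL j (g₁.mem hB h))
  have k₂ : ∀ B, IsBlock C₂ S₂ B → j ∉ B := fun B hB h => lt_irrefl _ (hL j (g₂.mem hB h))
  have c₁ : X₁ ∉ C₁ := fun h => k₁ X₁ (.inl h) t₁.mem
  have c₂ : X₂ ∉ C₂ := fun h => k₂ X₂ (.inl h) t₂.mem
  have e₁ : ∀ p ∈ S₁, p.2.Nonempty ∧ j ∉ p.2 := fun p hp =>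
    ⟨g₁.nonempty _ (.inr ⟨p.1, hp⟩), k₁ _ (.inr ⟨p.1, hp⟩)⟩
  have e₂ : ∀ p ∈ S₂, p.2.Nonempty ∧ j ∉ p.2 := fun p hp =>
    ⟨g₂.nonempty _ (.inr ⟨p.1, hp⟩), k₂ _ (.inr ⟨p.1, hp⟩)⟩
  rcases h₁ with rfl | rfl <;> rcases h₂ with h | h
  · obtain ⟨hC, rfl⟩ := Prod.mk.inj h
    have hX : X₁ = X₂ := by
      have : X₁ ∈ insert X₂ C₂ := hC ▸ Finset.mem_insert_self _ _
      exact (Finset.mem_insert.1 this).resolve_right fun h => k₂ X₁ (.inl h) t₁.mem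
    subst hX
    rw [t₁.unique t₂ e₁ e₂, ← Finset.erase_insert c₁, hC, Finset.erase_insert c₂]
  · obtain ⟨rfl, -⟩ := Prod.mk.inj h
    exact absurd t₁.mem (k₂ X₁ (.inl (Finset.mem_insert_self _ _)))
  · obtain ⟨rfl, -⟩ := Prod.mk.inj h
    exact absurd t₂.mem (k₁ X₂ (.inl (Finset.mem_insert_self _ _)))
  · obtain ⟨rfl, hS⟩ := Prod.mk.inj h
    obtain ⟨hp, rfl⟩ := List.cons.inj hS
    obtain ⟨-, rfl⟩ := Prod.mk.inj hp
    rw [t₁.unique t₂ e₁ e₂]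

theorem nodup_closeOrKeep {v : V} {X : Finset (Fin k)} : (closeOrKeep C v X S).Nodup := by
  simp only [closeOrKeep, List.nodup_cons, List.mem_singleton, List.not_mem_nil, not_false_iff,
    List.nodup_nil, and_true]
  intro h
  have := congrArg List.length (Prod.mk.inj h).2
  simp at this

theorem nodup_states (hG : ∀ v, ¬ G.Adj v v) (hL : L.Pairwise (· < ·)) :
    (states G ℓ L).Nodup := by
  induction L with
  | nil => exact List.nodup_singleton _
  | cons j L ih =>
    obtain ⟨hj, hL⟩ := List.pairwise_cons.1 hL
    refine List.nodup_flatMap.2 ⟨?_, ?_⟩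
    · rintro ⟨C, S⟩ -
      match S with
      | [] => exact nodup_closeOrKeep
      | (v, X) :: S =>
        rw [step]
        split_ifs
        exacts [nodup_closeOrKeep, nodup_closeOrKeep, List.nodup_nil]
    · refine (ih hL).pairwise_of_forall_ne ?_
      intro s hs t ht hst a has hat
      exact hst (step_injective hG hj ((mem_states hG hL).1 hs) ((mem_states hG hL).1 ht) has hat)

theorem anc_nil {W Z : Finset (Fin k)} : Anc ([] : List (V × Finset (Fin k))) W Z ↔ Nested W Z := by
  simp [Anc]

theorem isBlock_nil {B : Finset (Fin k)} : IsBlock C ([] : List (V × Finset (Fin k))) B ↔ B ∈ C := by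
  simp [IsBlock]

/-- The complete non-crossing partitions that are built are the elements of `NC_k(ℓ, G)`. -/
theorem good_finRange_iff : Good G ℓ (List.finRange k) C [] ↔ ∃ π : NC ℓ G, π.1.parts = C := by
  constructor
  · intro h
    have hne : ∀ B ∈ C, B.Nonempty := fun B hB => h.nonempty B (.inl hB)
    let π : Partition k := Finpartition.ofExistsUnique C (fun _ _ => Finset.subset_univ _)
      (fun x _ => by
        obtain ⟨B, hB, hx⟩ := (h.cover x).1 (List.mem_finRange x)
        refine ⟨B, ⟨isBlock_nil.1 hB, hx⟩, ?_⟩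
        rintro B' ⟨hB', hx'⟩
        exact h.disj _ _ _ (.inl hB') hB hx' hx)
      (fun h0 => Finset.not_nonempty_empty (hne _ h0))
    have hπ : π.parts = C := rfl
    refine ⟨⟨π, ⟨?_, ?_, ?_⟩⟩, rfl⟩
    · intro B hB B' hB' i hi i' hi' j hj j' hj'
      exact h.ncross B B' i i' j j' (.inl hB) (.inl hB') hi hi' hj hj'
    · exact fun B hB i hi j hj => h.label B i j (.inl hB) hi hj
    · rintro ⟨B, hB⟩ ⟨B', hB'⟩ ⟨hn, hcov⟩
      -- With an empty stack `Anc` is nesting, so the second alternative contradicts the covering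
      -- relation.
      rcases h.hom B B' (.inl hB) (.inl hB') (anc_nil.2 hn) with h1 | ⟨U, hU, h1, h2⟩
      · exact h1 _ (Finset.min'_mem _ _) _ (Finset.min'_mem _ _)
      · exact absurd ⟨⟨U, isBlock_nil.1 hU⟩, anc_nil.1 h1, anc_nil.1 h2⟩ hcov
  · rintro ⟨⟨π, hπ⟩, rfl⟩
    refine ⟨?_, ?_, ?_, ?_, ?_, ?_, ?_, ?_, ?_, ?_⟩
    · exact fun B hB => π.nonempty_of_mem_parts (isBlock_nil.1 hB)
    · intro x
      simp only [List.mem_finRange, true_iff, isBlock_nil]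
      exact π.exists_mem (Finset.mem_univ x)
    · exact fun B B' x hB hB' hx hx' =>
        π.eq_of_mem_parts (isBlock_nil.1 hB) (isBlock_nil.1 hB') hx hx'
    · simp
    · exact fun B x y hB hx hy => hπ.isConstantOnBlocks B (isBlock_nil.1 hB) x hx y hy
    · simp
    · exact List.Pairwise.nil
    · exact fun B B' i i' j j' hB hB' hi hi' hj hj' =>
        hπ.isNonCrossing B (isBlock_nil.1 hB) B' (isBlock_nil.1 hB') i hi i' hi' j hj j' hj'
    · simp
    · intro W Z hW hZ hWZ
      rw [isBlock_nil] at hW hZ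
      rw [anc_nil] at hWZ
      by_cases hU : ∃ B'' : π.parts, Nested W B''.1 ∧ Nested B''.1 Z
      · obtain ⟨⟨U, hU⟩, h1, h2⟩ := hU
        exact .inr ⟨U, isBlock_nil.2 hU, anc_nil.2 h1, anc_nil.2 h2⟩
      · left
        intro w hw z hz
        rw [hπ.isConstantOnBlocks.eq_blockLabel ⟨W, hW⟩ hw,
          hπ.isConstantOnBlocks.eq_blockLabel ⟨Z, hZ⟩ hz]
        exact hπ.isHom ⟨W, hW⟩ ⟨Z, hZ⟩ ⟨hWZ, hU⟩

/-- A sum over the complete partitions that are built is a sum over `NC_k(ℓ, G)`. -/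
theorem sum_states_eq_sum_NC (hG : ∀ v, ¬ G.Adj v v) (f : Finset (Finset (Fin k)) → ℂ) :
    ((states G ℓ (List.finRange k)).map fun s => if s.2.isEmpty then f s.1 else 0).sum =
      ∑ π : NC ℓ G, f π.1.parts := by
  classical
  have hL : (List.finRange k).Pairwise (· < ·) := List.pairwise_lt_finRange k
  rw [← List.sum_toFinset _ (nodup_states hG hL), ← Finset.sum_filter]
  symm
  refine Finset.sum_bij (fun π _ => (π.1.parts, [])) ?_ ?_ ?_ ?_
  · intro π _
    rw [Finset.mem_filter, List.mem_toFinset, mem_states hG hL]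
    exact ⟨good_finRange_iff.2 ⟨π, rfl⟩, rfl⟩
  · intro π _ π' _ h
    exact Subtype.ext (Finpartition.ext (Prod.mk.inj h).1)
  · rintro ⟨C, S⟩ h
    rw [Finset.mem_filter, List.mem_toFinset, mem_states hG hL, List.isEmpty_iff] at h
    obtain ⟨h, rfl⟩ := h
    obtain ⟨π, hπ⟩ := good_finRange_iff.1 h
    exact ⟨π, Finset.mem_univ _, by rw [hπ]⟩
  · intro π _
    rfl

end Enumeration

/-! ### Boolean cumulants of a vector functional -/

section Cumulants

variable {n : ℕ}

/-- The interval partitions of the points of the list `j :: L`: the block of `j` and the set of the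
other blocks. -/
def intervalStates : Fin n → List (Fin n) → List (Finset (Fin n) × Finset (Finset (Fin n)))
  | j, [] => [({j}, ∅)]
  | j, j' :: L => (intervalStates j' L).flatMap fun s =>
      [(insert j s.1, s.2), ({j}, insert s.1 s.2)]

/-- The blocks `X`, which contains `j`, and those in `C` form an interval partition of `j :: L`. -/
structure IsIntervalState (j : Fin n) (L : List (Fin n)) (X : Finset (Fin n))
    (C : Finset (Finset (Fin n))) : Prop where
  mem : j ∈ X
  notMem : X ∉ C
  nonempty : ∀ B ∈ insert X C, B.Nonempty
  cover : ∀ x, x ∈ j :: L ↔ ∃ B ∈ insert X C, x ∈ B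
  disj : ∀ B ∈ insert X C, ∀ B' ∈ insert X C, ∀ x ∈ B, x ∈ B' → B = B'
  convex : ∀ B ∈ insert X C, ∀ x ∈ B, ∀ y ∈ B, ∀ z ∈ j :: L, x < z → z < y → z ∈ B

variable {j j' : Fin n} {L : List (Fin n)} {X : Finset (Fin n)} {C : Finset (Finset (Fin n))}

theorem IsIntervalState.mem_list (h : IsIntervalState j L X C) {B : Finset (Fin n)}
    (hB : B ∈ insert X C) {x : Fin n} (hx : x ∈ B) : x ∈ j :: L :=
  (h.cover x).2 ⟨B, hB, hx⟩

theorem IsIntervalState.insert_left (hL : (j :: j' :: L).Pairwise (· < ·))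
    (h : IsIntervalState j' L X C) : IsIntervalState j (j' :: L) (insert j X) C := by
  obtain ⟨hj, hL'⟩ := List.pairwise_cons.1 hL
  have hlt : ∀ B ∈ insert X C, ∀ x ∈ B, j < x := fun B hB x hx => hj x (h.mem_list hB hx)
  have hC : ∀ B ∈ C, B ∈ insert X C := fun B => Finset.mem_insert_of_mem
  have hX : X ∈ insert X C := Finset.mem_insert_self _ _
  have hdisj : ∀ B ∈ C, ∀ x ∈ B, x ∉ insert j X := by
    intro B hB x hx hx'
    rcases Finset.mem_insert.1 hx' with rfl | hx'
    · exact lt_irrefl _ (hlt B (hC B hB) x hx)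
    · exact h.notMem (h.disj _ (hC B hB) _ hX x hx hx' ▸ hB)
  refine ⟨Finset.mem_insert_self _ _, ?_, ?_, ?_, ?_, ?_⟩
  · intro hjX
    exact lt_irrefl _ (hlt _ (hC _ hjX) j (Finset.mem_insert_self _ _))
  · intro B hB
    rcases Finset.mem_insert.1 hB with rfl | hB
    · simp
    · exact h.nonempty B (hC B hB)
  · intro x
    rw [List.mem_cons, h.cover]
    simp only [Finset.exists_mem_insert]
    rw [Finset.mem_insert]
    tauto
  · intro B hB B' hB' x hx hx'
    rcases Finset.mem_insert.1 hB with rfl | hB <;> rcases Finset.mem_insert.1 hB' with rfl | hB'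
    · rfl
    · exact absurd hx (hdisj _ hB' x hx')
    · exact absurd hx' (hdisj _ hB x hx)
    · exact h.disj B (hC B hB) B' (hC B' hB') x hx hx'
  · intro B hB x hx y hy z hz hxz hzy
    rcases Finset.mem_insert.1 hB with rfl | hB
    · rcases Finset.mem_insert.1 hx with rfl | hx
      · have hz' : z ∈ j' :: L := (List.mem_cons.1 hz).resolve_left hxz.ne'
        have hy' : y ∈ X := (Finset.mem_insert.1 hy).resolve_left (hxz.trans hzy).ne'
        refine Finset.mem_insert_of_mem ?_
        rcases List.mem_cons.1 hz' with rfl | hz''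
        · exact h.mem
        · exact h.convex X hX j' h.mem y hy' z hz' ((List.pairwise_cons.1 hL').1 z hz'') hzy
      · have h1 := hlt X hX x hx
        exact Finset.mem_insert_of_mem (h.convex X hX x hx y
          ((Finset.mem_insert.1 hy).resolve_left (h1.trans (hxz.trans hzy)).ne') z
          ((List.mem_cons.1 hz).resolve_left (h1.trans hxz).ne') hxz hzy)
    · have h1 := hlt B (hC B hB) x hx
      exact h.convex B (hC B hB) x hx y hy z
        ((List.mem_cons.1 hz).resolve_left (h1.trans hxz).ne') hxz hzy

theorem IsIntervalState.singleton_left (hL : (j :: j' :: L).Pairwise (· < ·))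
    (h : IsIntervalState j' L X C) : IsIntervalState j (j' :: L) {j} (insert X C) := by
  obtain ⟨hj, hL'⟩ := List.pairwise_cons.1 hL
  have hlt : ∀ B ∈ insert X C, ∀ x ∈ B, j < x := fun B hB x hx => hj x (h.mem_list hB hx)
  refine ⟨Finset.mem_singleton_self _, ?_, ?_, ?_, ?_, ?_⟩
  · intro hjX
    exact lt_irrefl _ (hlt _ hjX j (Finset.mem_singleton_self _))
  · intro B hB
    rcases Finset.mem_insert.1 hB with rfl | hB
    · simp
    · exact h.nonempty B hB
  · intro x
    rw [List.mem_cons, h.cover]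
    simp only [Finset.exists_mem_insert, Finset.mem_singleton]
  · intro B hB B' hB' x hx hx'
    rcases Finset.mem_insert.1 hB with rfl | hB <;> rcases Finset.mem_insert.1 hB' with rfl | hB'
    · rfl
    · exact absurd (Finset.mem_singleton.1 hx).symm (hlt _ hB' x hx').ne
    · exact absurd (Finset.mem_singleton.1 hx').symm (hlt _ hB x hx).ne
    · exact h.disj B hB B' hB' x hx hx'
  · intro B hB x hx y hy z hz hxz hzy
    rcases Finset.mem_insert.1 hB with rfl | hB
    · grind
    · have h1 := hlt B hB x hx
      exact h.convex B hB x hx y hy z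
        ((List.mem_cons.1 hz).resolve_left (h1.trans hxz).ne') hxz hzy

theorem IsIntervalState.exists_singleton (hL : (j :: j' :: L).Pairwise (· < ·))
    (h : IsIntervalState j (j' :: L) {j} C) :
    ∃ X D, IsIntervalState j' L X D ∧ C = insert X D := by
  obtain ⟨hj, hL'⟩ := List.pairwise_cons.1 hL
  obtain ⟨X, hX, hjX⟩ := (h.cover j').1 (by simp)
  have hXC : X ∈ C := (Finset.mem_insert.1 hX).resolve_left (by
    rintro rfl
    exact (hj j' (by simp)).ne' (Finset.mem_singleton.1 hjX))
  have hC : ∀ B ∈ C, B ∈ insert {j} C := fun B => Finset.mem_insert_of_mem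
  have hne : ∀ B ∈ C, j ∉ B := by
    intro B hB hjB
    exact h.notMem (h.disj B (hC B hB) {j} (by simp) j hjB (by simp) ▸ hB)
  refine ⟨X, C.erase X, ⟨hjX, by simp, ?_, ?_, ?_, ?_⟩, (Finset.insert_erase hXC).symm⟩ <;>
    rw [Finset.insert_erase hXC]
  · exact fun B hB => h.nonempty B (hC B hB)
  · intro x
    constructor
    · intro hx
      obtain ⟨B, hB, hxB⟩ := (h.cover x).1 (List.mem_cons_of_mem _ hx)
      refine ⟨B, (Finset.mem_insert.1 hB).resolve_left ?_, hxB⟩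
      rintro rfl
      exact (hj x hx).ne' (Finset.mem_singleton.1 hxB)
    · rintro ⟨B, hB, hxB⟩
      refine (List.mem_cons.1 (h.mem_list (hC B hB) hxB)).resolve_left ?_
      rintro rfl
      exact hne B hB hxB
  · exact fun B hB B' hB' => h.disj B (hC B hB) B' (hC B' hB')
  · exact fun B hB x hx y hy z hz => h.convex B (hC B hB) x hx y hy z (List.mem_cons_of_mem _ hz)

/-- A block of `j` with a further element also contains the next point `j'`, by convexity, so what
remains is the block of `j'`. -/
theorem IsIntervalState.erase (hL : (j :: j' :: L).Pairwise (· < ·))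
    (h : IsIntervalState j (j' :: L) X C) (hXj : X ≠ {j}) :
    IsIntervalState j' L (X.erase j) C := by
  obtain ⟨hj, hL'⟩ := List.pairwise_cons.1 hL
  have hX : X ∈ insert X C := Finset.mem_insert_self _ _
  have hC : ∀ B ∈ C, B ∈ insert X C := fun B => Finset.mem_insert_of_mem
  have hdis : ∀ B ∈ C, ∀ x ∈ B, x ∉ X := by
    intro B hB x hx hxX
    exact h.notMem (h.disj B (hC B hB) X hX x hx hxX ▸ hB)
  have hne : (X.erase j).Nonempty := by
    by_contra hne
    rw [Finset.not_nonempty_iff_eq_empty, Finset.erase_eq_empty_iff] at hne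
    rcases hne with rfl | hne
    · exact absurd h.mem (Finset.notMem_empty _)
    · exact hXj hne
  have hmem : j' ∈ X.erase j := by
    obtain ⟨y, hy⟩ := hne
    obtain ⟨hyj, hyX⟩ := Finset.mem_erase.1 hy
    have hy' := (List.mem_cons.1 (h.mem_list hX hyX)).resolve_left hyj
    have h1 := hj j' (by simp)
    refine Finset.mem_erase.2 ⟨h1.ne', ?_⟩
    rcases List.mem_cons.1 hy' with rfl | hy''
    · exact hyX
    · exact h.convex X hX j h.mem y hyX j' (by simp) h1 ((List.pairwise_cons.1 hL').1 y hy'')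
  refine ⟨hmem, fun h' => hdis _ h' j' hmem (Finset.mem_of_mem_erase hmem), ?_, ?_, ?_, ?_⟩
  · intro B hB
    rcases Finset.mem_insert.1 hB with rfl | hB
    · exact hne
    · exact h.nonempty B (hC B hB)
  · intro x
    have hjj : ∀ B ∈ C, x ∈ B → x ≠ j := by
      rintro B hB hxB rfl
      exact hdis B hB _ hxB h.mem
    have h1 := h.cover x
    simp only [Finset.exists_mem_insert, Finset.mem_erase] at h1 ⊢
    constructor
    · intro hx
      rcases h1.1 (List.mem_cons_of_mem _ hx) with h2 | h2
      · exact .inl ⟨(hj x hx).ne', h2⟩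
      · exact .inr h2
    · rintro (⟨h2, h3⟩ | ⟨B, hB, hxB⟩)
      · exact (List.mem_cons.1 (h1.2 (.inl h3))).resolve_left h2
      · exact (List.mem_cons.1 (h1.2 (.inr ⟨B, hB, hxB⟩))).resolve_left (hjj B hB hxB)
  · intro B hB B' hB' x hx hx'
    rcases Finset.mem_insert.1 hB with rfl | hB <;> rcases Finset.mem_insert.1 hB' with rfl | hB'
    · rfl
    · exact absurd (Finset.mem_of_mem_erase hx) (hdis _ hB' x hx')
    · exact absurd (Finset.mem_of_mem_erase hx') (hdis _ hB x hx)
    · exact h.disj B (hC B hB) B' (hC B' hB') x hx hx'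
  · intro B hB x hx y hy z hz hxz hzy
    rcases Finset.mem_insert.1 hB with rfl | hB
    · exact Finset.mem_erase.2 ⟨(hj z hz).ne', h.convex X hX x (Finset.mem_of_mem_erase hx) y
        (Finset.mem_of_mem_erase hy) z (List.mem_cons_of_mem _ hz) hxz hzy⟩
    · exact h.convex B (hC B hB) x hx y hy z (List.mem_cons_of_mem _ hz) hxz hzy

theorem isIntervalState_nil : IsIntervalState j [] X C ↔ X = {j} ∧ C = ∅ := by
  constructor
  · intro h
    have h1 : ∀ B ∈ insert X C, B = {j} := fun B hB =>
      Finset.eq_singleton_iff_nonempty_unique_mem.2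
        ⟨h.nonempty B hB, fun x hx => List.mem_singleton.1 (h.mem_list hB hx)⟩
    obtain rfl : X = {j} := h1 X (Finset.mem_insert_self _ _)
    refine ⟨rfl, Finset.eq_empty_of_forall_notMem fun B hB => h.notMem ?_⟩
    rwa [← h1 B (Finset.mem_insert_of_mem hB)]
  · rintro ⟨rfl, rfl⟩
    refine ⟨by simp, by simp, by simp, by simp, by simp, ?_⟩
    grind

theorem mem_intervalStates (hL : (j :: L).Pairwise (· < ·)) :
    (X, C) ∈ intervalStates j L ↔ IsIntervalState j L X C := by
  induction L generalizing j X C with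
  | nil => simp [isIntervalState_nil, intervalStates]
  | cons j' L ih =>
    have hL' := (List.pairwise_cons.1 hL).2
    simp only [intervalStates, List.mem_flatMap, Prod.exists, ih hL', List.mem_cons,
      List.not_mem_nil, or_false, Prod.mk.injEq]
    constructor
    · rintro ⟨Y, D, h, ⟨rfl, rfl⟩ | ⟨rfl, rfl⟩⟩
      · exact h.insert_left hL
      · exact h.singleton_left hL
    · intro h
      by_cases hX : X = {j}
      · subst hX
        obtain ⟨Y, D, h1, h2⟩ := h.exists_singleton hL
        exact ⟨Y, D, h1, .inr ⟨rfl, h2⟩⟩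
      · exact ⟨X.erase j, C, h.erase hL hX, .inl ⟨(Finset.insert_erase h.mem).symm, rfl⟩⟩

theorem nodup_intervalStates (hL : (j :: L).Pairwise (· < ·)) : (intervalStates j L).Nodup := by
  induction L generalizing j with
  | nil => exact List.nodup_singleton _
  | cons j' L ih =>
    obtain ⟨hj, hL'⟩ := List.pairwise_cons.1 hL
    have hnot : ∀ {X C}, IsIntervalState j' L X C → ∀ B ∈ insert X C, j ∉ B :=
      fun h B hB hjB => lt_irrefl _ (hj j (h.mem_list hB hjB))
    have hne : ∀ {X C}, IsIntervalState j' L X C → insert j X ≠ {j} := by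
      intro X C h h'
      have := Finset.mem_insert_of_mem (b := j) h.mem
      rw [h', Finset.mem_singleton] at this
      exact (hj j' (by simp)).ne' this
    rw [intervalStates]
    refine List.nodup_flatMap.2 ⟨?_, ?_⟩
    · rintro ⟨X, C⟩ hs
      have := hne ((mem_intervalStates hL').1 hs)
      simp [this]
    · refine (ih hL').pairwise_of_forall_ne ?_
      rintro ⟨X, C⟩ hs ⟨Y, D⟩ ht hst ⟨Z, E⟩ h1 h2
      rw [mem_intervalStates hL'] at hs ht
      apply hst
      simp only [List.mem_cons, List.not_mem_nil, or_false, Prod.mk.injEq] at h1 h2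
      rcases h1 with ⟨rfl, rfl⟩ | ⟨rfl, rfl⟩ <;> rcases h2 with ⟨h1, h2⟩ | ⟨h1, h2⟩
      · rw [← Finset.erase_insert (hnot hs X (by simp)), h1,
          Finset.erase_insert (hnot ht Y (by simp)), h2]
      · exact absurd h1 (hne hs)
      · exact absurd h1.symm (hne ht)
      · have hXY : X = Y := by
          have hX : X ∈ insert Y D := h2 ▸ Finset.mem_insert_self _ _
          exact ht.disj X hX Y (Finset.mem_insert_self _ _) j' hs.mem ht.mem
        subst hXY
        rw [← Finset.erase_insert hs.notMem, h2, Finset.erase_insert ht.notMem]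

theorem isIntervalState_finRange (hL : j :: L = List.finRange n) {π : Partition n}
    (hπ : π.IsInterval) : IsIntervalState j L (π.part j) (π.parts.erase (π.part j)) := by
  have hpart : π.part j ∈ π.parts := π.part_mem.2 (Finset.mem_univ j)
  refine ⟨π.mem_part_self.2 (Finset.mem_univ j), by simp, ?_, ?_, ?_, ?_⟩ <;>
    rw [Finset.insert_erase hpart]
  · exact fun B hB => π.nonempty_of_mem_parts hB
  · intro x
    simp only [hL, List.mem_finRange, true_iff]
    exact π.exists_mem (Finset.mem_univ x)
  · exact fun B hB B' hB' x hx hx' => π.eq_of_mem_parts hB hB' hx hx'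
  · intro B hB x hx y hy z _ hxz hzy
    obtain ⟨a, b, -, rfl⟩ := hπ B hB
    rw [Finset.mem_Icc] at *
    exact ⟨hx.1.trans hxz.le, hzy.le.trans hy.2⟩

theorem IsIntervalState.exists_partition (hL : j :: L = List.finRange n)
    (h : IsIntervalState j L X C) :
    ∃ π : Partition n, π.IsInterval ∧ π.part j = X ∧ π.parts.erase (π.part j) = C := by
  have hX : X ∈ insert X C := Finset.mem_insert_self _ _
  let π : Partition n := Finpartition.ofExistsUnique (insert X C)
    (fun _ _ => Finset.subset_univ _)
    (fun x _ => by
      obtain ⟨B, hB, hx⟩ := (h.cover x).1 (hL ▸ List.mem_finRange x)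
      refine ⟨B, ⟨hB, hx⟩, ?_⟩
      rintro B' ⟨hB', hx'⟩
      exact h.disj _ hB' _ hB x hx' hx)
    (fun h0 => Finset.not_nonempty_empty (h.nonempty _ h0))
  have hπ : π.parts = insert X C := rfl
  have hpart : π.part j = X := π.part_eq_of_mem (hπ ▸ hX) h.mem
  refine ⟨π, ?_, hpart, by rw [hpart, hπ, Finset.erase_insert h.notMem]⟩
  intro B hB
  have hne := h.nonempty B hB
  refine ⟨B.min' hne, B.max' hne, Finset.min'_le _ _ (Finset.max'_mem _ _), ?_⟩
  ext z
  rw [Finset.mem_Icc]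
  constructor
  · exact fun hz => ⟨Finset.min'_le _ _ hz, Finset.le_max' _ _ hz⟩
  · rintro ⟨h1, h2⟩
    rcases h1.eq_or_lt with rfl | h1
    · exact Finset.min'_mem _ _
    rcases h2.eq_or_lt with rfl | h2
    · exact Finset.max'_mem _ _
    exact h.convex B hB _ (Finset.min'_mem _ _) _ (Finset.max'_mem _ _) z
      (hL ▸ List.mem_finRange z) h1 h2

open Classical in
theorem sum_intervalStates (hL : j :: L = List.finRange n) (f : Finset (Finset (Fin n)) → ℂ) :
    ((intervalStates j L).map fun s => f (insert s.1 s.2)).sum =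
      ∑ π : Partition n with π.IsInterval, f π.parts := by
  have hs : (j :: L).Pairwise (· < ·) := hL ▸ List.pairwise_lt_finRange n
  rw [← List.sum_toFinset _ (nodup_intervalStates hs)]
  symm
  have hins : ∀ π : Partition n, insert (π.part j) (π.parts.erase (π.part j)) = π.parts :=
    fun π => Finset.insert_erase (π.part_mem.2 (Finset.mem_univ j))
  refine Finset.sum_bij (fun π _ => (π.part j, π.parts.erase (π.part j))) ?_ ?_ ?_ ?_
  · intro π hπ
    rw [List.mem_toFinset, mem_intervalStates hs]
    exact isIntervalState_finRange hL (Finset.mem_filter.1 hπ).2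
  · intro π _ π' _ h
    obtain ⟨h1, h2⟩ := Prod.mk.inj h
    apply Finpartition.ext
    rw [← hins π, ← hins π', h2, h1]
  · rintro ⟨X, C⟩ h
    rw [List.mem_toFinset, mem_intervalStates hs] at h
    obtain ⟨π, h1, h2, h3⟩ := h.exists_partition hL
    exact ⟨π, Finset.mem_filter.2 ⟨Finset.mem_univ _, h1⟩, Prod.ext h2 h3⟩
  · intro π _
    rw [hins]

theorem sort_insert_of_lt (h : ∀ x ∈ X, j < x) :
    (insert j X).sort (· ≤ ·) = j :: X.sort (· ≤ ·) :=
  Finset.sort_insert _ (fun x hx => (h x hx).le) fun hj => lt_irrefl _ (h j hj)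

variable {E : Type*} [NormedAddCommGroup E] [InnerProductSpace ℂ E]

/-- The vector `a₁ Q a₂ Q ⋯ Q aₘ ξ`, where `Q x = x - ⟨ξ, x⟩ ξ`. -/
def cutVector (ξ : E) : (E →L[ℂ] E) → List (E →L[ℂ] E) → E
  | a, [] => a ξ
  | a, b :: l => a (cutVector ξ b l - ⟪ξ, cutVector ξ b l⟫_ℂ • ξ)

/-- In each Q = 1 - |ξ⟩⟨ξ|, the identity joins the new point to the block on its right, while the
projection cuts there and turns that block into a moment with a sign. The leftmost block still acts
on ξ. -/
theorem cutVector_eq_sum (ξ : E) (b : Fin n → E →L[ℂ] E) (hL : (j :: L).Pairwise (· < ·)) :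
    cutVector ξ (b j) (L.map b) = ((intervalStates j L).map fun s =>
      ((-1) ^ s.2.card * ∏ B ∈ s.2, vectorState ξ ((B.sort (· ≤ ·)).map b).prod) •
        ((s.1.sort (· ≤ ·)).map b).prod ξ).sum := by
  induction L generalizing j with
  | nil => simp [cutVector, intervalStates]
  | cons j' L ih =>
    obtain ⟨hj, hL'⟩ := List.pairwise_cons.1 hL
    have hlin : ∀ l : List (Finset (Fin n) × Finset (Finset (Fin n))),
        (∀ s ∈ l, IsIntervalState j' L s.1 s.2) → ∀ f : _ → E, f = (fun s =>
      ((-1) ^ s.2.card * ∏ B ∈ s.2, vectorState ξ ((B.sort (· ≤ ·)).map b).prod) •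
        ((s.1.sort (· ≤ ·)).map b).prod ξ) →
        b j ((l.map f).sum - ⟪ξ, (l.map f).sum⟫_ℂ • ξ) =
        ((l.flatMap fun s => [(insert j s.1, s.2), ({j}, insert s.1 s.2)]).map f).sum := by
      intro l hl f hf
      induction l with
      | nil => simp
      | cons s l ihl =>
        have hs := hl s List.mem_cons_self
        have hlt : ∀ x ∈ s.1, j < x := fun x hx =>
          hj x (hs.mem_list (Finset.mem_insert_self _ _) hx)
        have e1 : f (insert j s.1, s.2) = b j (f s) := by
          simp only [hf, sort_insert_of_lt hlt, List.map_cons, List.prod_cons, map_smul]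
          rfl
        have e2 : f ({j}, insert s.1 s.2) = - (⟪ξ, f s⟫_ℂ • b j ξ) := by
          simp only [hf, Finset.card_insert_of_notMem hs.notMem,
            Finset.prod_insert hs.notMem, Finset.sort_singleton, List.map_cons, List.map_nil,
            List.prod_cons, List.prod_nil, mul_one, inner_smul_right, ← neg_smul]
          congr 1
          simp only [vectorState]
          ring
        rw [List.flatMap_cons, List.map_append, List.sum_append,
          ← ihl fun t ht => hl t (List.mem_cons_of_mem _ ht)]
        simp only [List.map_cons, List.sum_cons, List.map_nil, List.sum_nil, e1, e2, map_sub,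
          map_add, map_smul, inner_add_right, add_smul]
        abel
    rw [List.map_cons, cutVector, ih hL', intervalStates]
    exact hlin _ (fun s hs => (mem_intervalStates hL').1 hs) _ rfl

/-- The boolean cumulant for a vector functional is `⟨ξ, a₁ Q a₂ Q ⋯ Q aₙ ξ⟩`. -/
theorem booleanCumulant_vectorState (ξ : E) (b : Fin n → E →L[ℂ] E) {a : E →L[ℂ] E}
    {l : List (E →L[ℂ] E)} (h : List.ofFn b = a :: l) :
    booleanCumulant (vectorState ξ) b = ⟪ξ, cutVector ξ a l⟫_ℂ := by
  rw [List.ofFn_eq_map] at h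
  obtain ⟨j, L, hL, rfl, rfl⟩ := List.map_eq_cons_iff.1 h
  have hs : (j :: L).Pairwise (· < ·) := hL ▸ List.pairwise_lt_finRange n
  rw [cutVector_eq_sum ξ b hs, booleanCumulant, ← sum_intervalStates hL.symm fun P =>
    (-1) ^ (P.card - 1) * ∏ B ∈ P, vectorState ξ ((B.sort (· ≤ ·)).map b).prod]
  have hin : ∀ l : List E, ⟪ξ, l.sum⟫_ℂ = (l.map fun x => ⟪ξ, x⟫_ℂ).sum := fun l =>
    map_list_sum (innerSL ℂ ξ) l
  rw [hin, List.map_map]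
  congr 1
  refine List.map_congr_left fun s hs' => ?_
  have h1 := ((mem_intervalStates hs).1 hs').notMem
  -- The exponent |σ| - 1 counts the blocks other than that of the first point, which are those in
  -- `s.2`.
  simp only [Function.comp_apply, Finset.card_insert_of_notMem h1, Finset.prod_insert h1,
    inner_smul_right, Nat.add_sub_cancel]
  simp only [vectorState]
  ring

end Cumulants

/-! ### Expansion of the product of operators over the states -/

section Expansion

variable {V : Type*} (G : Digraph V) {H : V → Type u} [∀ v, NormedAddCommGroup (H v)]
  [∀ v, InnerProductSpace ℂ (H v)] (ξ : ∀ v, H v) {k : ℕ} {ℓ : Fin k → V}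
  (a : ∀ j, H (ℓ j) →L[ℂ] H (ℓ j))

open Classical in
/-- The operator `a_j` on `H_v` if `ℓ(j) = v`. -/
def opAt (v : V) (j : Fin k) : H v →L[ℂ] H v :=
  if h : ℓ j = v then castOp h (a j) else 0

theorem opAt_self (j : Fin k) : opAt a (ℓ j) j = a j := by
  simp [opAt, castOp]

/-- The vector `a_{j₁} Q ⋯ Q a_{jₘ} ξ_v` of a block `{j₁ < ⋯ < jₘ}`. -/
def blockVector (v : V) (X : Finset (Fin k)) : H v :=
  match (X.sort (· ≤ ·)).map (opAt a v) with
  | [] => 0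
  | b :: l => cutVector (ξ v) b l

theorem blockVector_singleton (j : Fin k) : blockVector ξ a (ℓ j) {j} = a j (ξ (ℓ j)) := by
  simp [blockVector, cutVector, opAt_self]

/-- The projection onto H_v° is the Q of `cutVector`, so the factor stored for an open block is what
the next operator of that block acts on. -/
theorem blockVector_insert {j : Fin k} (hξ : ‖ξ (ℓ j)‖ = 1) {X : Finset (Fin k)}
    (hX : X.Nonempty) (h : ∀ x ∈ X, j < x) : blockVector ξ a (ℓ j) (insert j X) =
      a j (toCirc H ξ (ℓ j) (blockVector ξ a (ℓ j) X) : H (ℓ j)) := by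
  rw [coe_toCirc H ξ hξ, blockVector, blockVector, sort_insert_of_lt h, List.map_cons, opAt_self]
  cases hs : X.sort (· ≤ ·) with
  | nil =>
    obtain ⟨x, hx⟩ := hX
    rw [← Finset.mem_sort (· ≤ ·), hs] at hx
    exact absurd hx List.not_mem_nil
  | cons y l => rfl

open Classical in
/-- The contribution of a closed block. -/
def blockWeight (B : Finset (Fin k)) : ℂ :=
  if h : B.Nonempty then ⟪ξ (ℓ (B.min' h)), blockVector ξ a (ℓ (B.min' h)) B⟫_ℂ else 0

theorem blockWeight_eq {B : Finset (Fin k)} {v : V} (h : B.Nonempty) (hv : ∀ x ∈ B, ℓ x = v) :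
    blockWeight ξ a B = ⟪ξ v, blockVector ξ a v B⟫_ℂ := by
  rw [blockWeight, dif_pos h, hv _ (B.min'_mem h)]

/-- The tensor product of the vectors of the open blocks. -/
def stackTensor : (S : List (V × Finset (Fin k))) → PathSpace H ξ (S.map Prod.fst)
  | [] => ((EuclideanSpace.single PUnit.unit (1 : ℂ) : EuclideanSpace ℂ PUnit.{u + 1}) :
      UniformSpace.Completion (EuclideanSpace ℂ PUnit.{u + 1}))
  | (v, X) :: S => prependTensor H ξ v (S.map Prod.fst) (toCirc H ξ v (blockVector ξ a v X))
      (stackTensor S)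

/-- The labels of the open blocks form a reverse path. -/
abbrev IsPath (S : List (V × Finset (Fin k))) : Prop :=
  (S.map Prod.fst).IsChain fun v w => G.Adj w v

open Classical in
/-- The vector of the `G`-free product that is given by the open blocks. -/
def stackVector (S : List (V × Finset (Fin k))) : ProductSpace G H ξ :=
  if h : IsPath G S then pathIncl G H ξ ⟨S.map Prod.fst, h⟩ (stackTensor ξ a S) else 0

/-- The vector that is given by a partially built partition. -/
def stateVector (s : BlockState k V) : ProductSpace G H ξ :=
  (∏ B ∈ s.1, blockWeight ξ a B) • stackVector G ξ a s.2

variable {G}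

theorem isPath_cons {v : V} {X : Finset (Fin k)} {S : List (V × Finset (Fin k))} :
    IsPath G ((v, X) :: S) ↔ (∀ w ∈ (S.map Prod.fst).head?, G.Adj w v) ∧ IsPath G S := by
  rw [IsPath, List.map_cons, List.isChain_cons]

theorem head_map_fst {S : List (V × Finset (Fin k))} {v : V} :
    (∀ w ∈ (S.map Prod.fst).head?, G.Adj w v) ↔ ∀ p ∈ S.head?, G.Adj p.1 v := by
  cases S <;> simp

/-- Consequently the default value 0 in `stackVector` never occurs on a reachable state. -/
theorem isPath_of_mem_states (hG : ∀ v, ¬ G.Adj v v) {L : List (Fin k)} {s : BlockState k V}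
    (hs : s ∈ states G ℓ L) : IsPath G s.2 := by
  induction L generalizing s with
  | nil =>
    rw [states, List.mem_singleton] at hs
    subst hs
    exact List.IsChain.nil
  | cons j L ih =>
    rw [states, List.mem_flatMap] at hs
    obtain ⟨⟨C, S⟩, ht, hs⟩ := hs
    have hS : IsPath G S := ih ht
    obtain ⟨X', S', hT, hs⟩ := (mem_step hG).1 hs
    have key : IsPath G ((ℓ j, X') :: S') := by
      rcases hT with ⟨rfl, rfl, hadj⟩ | ⟨X, rfl, rfl⟩
      · exact isPath_cons.2 ⟨head_map_fst.2 hadj, hS⟩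
      · exact hS
    rcases hs with rfl | rfl
    · exact (isPath_cons.1 key).2
    · exact key

theorem sum_closeOrKeep {C : Finset (Finset (Fin k))} {v : V} {X : Finset (Fin k)}
    {S : List (V × Finset (Fin k))} (hXC : X ∉ C) (hX : X.Nonempty) (hv : ∀ x ∈ X, ℓ x = v) :
    ((closeOrKeep C v X S).map (stateVector G ξ a)).sum = (∏ B ∈ C, blockWeight ξ a B) •
      (⟪ξ v, blockVector ξ a v X⟫_ℂ • stackVector G ξ a S + stackVector G ξ a ((v, X) :: S)) := by
  simp only [closeOrKeep, List.map_cons, List.map_nil, List.sum_cons, List.sum_nil, stateVector,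
    Finset.prod_insert hXC, blockWeight_eq ξ a hX hv, smul_add, smul_smul, add_zero]
  rw [mul_comm]

variable [∀ v, CompleteSpace (H v)]

theorem iota_stackVector_push {j : Fin k} (hG : ∀ v, ¬ G.Adj v v) (hξ : ∀ v, ‖ξ v‖ = 1)
    {S : List (V × Finset (Fin k))} (hS : IsPath G S) (hadj : ∀ p ∈ S.head?, G.Adj p.1 (ℓ j)) :
    iota G H ξ (ℓ j) (a j) (stackVector G ξ a S) =
      ⟪ξ (ℓ j), blockVector ξ a (ℓ j) {j}⟫_ℂ • stackVector G ξ a S +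
        stackVector G ξ a ((ℓ j, {j}) :: S) := by
  have h2 := isPath_cons (X := {j}).2 ⟨head_map_fst.2 hadj, hS⟩
  have h := iota_pathInto (hG (ℓ j)) (hξ (ℓ j)) (a j) ⟨⟨_, hS⟩, head_map_fst.2 hadj⟩
    (stackTensor ξ a S)
  rw [stackVector, dif_pos hS, stackVector, dif_pos h2, blockVector_singleton]
  refine h.trans ?_
  rw [← blockVector_singleton]
  rfl

theorem iota_stackVector_extend {j : Fin k} (hG : ∀ v, ¬ G.Adj v v) (hξ : ∀ v, ‖ξ v‖ = 1)
    {S : List (V × Finset (Fin k))} {X : Finset (Fin k)} (hX : X.Nonempty) (hlt : ∀ x ∈ X, j < x)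
    (hS : IsPath G ((ℓ j, X) :: S)) :
    iota G H ξ (ℓ j) (a j) (stackVector G ξ a ((ℓ j, X) :: S)) =
      ⟪ξ (ℓ j), blockVector ξ a (ℓ j) (insert j X)⟫_ℂ • stackVector G ξ a S +
        stackVector G ξ a ((ℓ j, insert j X) :: S) := by
  have h2 : IsPath G ((ℓ j, insert j X) :: S) := hS
  have h3 := isPath_cons.1 hS
  have h := iota_prepend (hG (ℓ j)) (hξ (ℓ j)) (a j) ⟨⟨_, h3.2⟩, h3.1⟩
    (toCirc H ξ (ℓ j) (blockVector ξ a (ℓ j) X)) (stackTensor ξ a S)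
  rw [← blockVector_insert ξ a (hξ _) hX hlt] at h
  rw [stackVector, dif_pos hS, stackVector, dif_pos h3.2, stackVector, dif_pos h2]
  exact h

/-- The branches of `step` are the cases in the action of ι_v: push is `iota_pathInto`, extension is
`iota_prepend`, and the empty list is `iota_eq_zero`. -/
theorem iota_stateVector {j : Fin k} {L : List (Fin k)} (hG : ∀ v, ¬ G.Adj v v)
    (hξ : ∀ v, ‖ξ v‖ = 1) (hL : ∀ x ∈ L, j < x) {C : Finset (Finset (Fin k))}
    {S : List (V × Finset (Fin k))} (h : Good G ℓ L C S) (hS : IsPath G S) :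
    iota G H ξ (ℓ j) (a j) (stateVector G ξ a (C, S)) =
      ((step G ℓ j (C, S)).map (stateVector G ξ a)).sum := by
  -- A block that contains `j` is new, so closing it adds exactly one factor to the product over
  -- `C`.
  have hC : ∀ X, j ∈ X → X ∉ C := fun X hj hX => lt_irrefl _ (hL j (h.mem (.inl hX) hj))
  rw [stateVector, map_smul]
  match S, h, hS with
  | [], h, hS =>
    rw [step, sum_closeOrKeep ξ a (hC _ (by simp)) (by simp) (by simp),
      iota_stackVector_push ξ a hG hξ hS (by simp)]
  | (v, X) :: S, h, hS =>
    have hX : IsBlock C ((v, X) :: S) X := isBlock_cons.2 (.inl rfl)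
    rw [step]
    split_ifs with h1 h2
    · subst h1
      have hlab : ∀ x ∈ insert j X, ℓ x = ℓ j := by
        intro x hx
        rcases Finset.mem_insert.1 hx with rfl | hx
        exacts [rfl, h.stackLabel _ X x List.mem_cons_self hx]
      rw [sum_closeOrKeep ξ a (hC _ (by simp)) (by simp) hlab, iota_stackVector_extend ξ a hG hξ
        (h.nonempty X hX) (fun x hx => hL x (h.mem hX hx)) hS]
    · rw [sum_closeOrKeep ξ a (hC _ (by simp)) (by simp) (by simp),
        iota_stackVector_push ξ a hG hξ hS (by simpa using h2)]
    · rw [stackVector, dif_pos hS, iota_eq_zero _ _ ⟨v, rfl, h1, h2⟩]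
      simp

/-- The expansion of `ι(a_{j₁}) ⋯ ι(a_{jₘ}) ξ` over the partially built partitions. -/
theorem prod_iota_vacuum (hG : ∀ v, ¬ G.Adj v v) (hξ : ∀ v, ‖ξ v‖ = 1) {L : List (Fin k)}
    (hL : L.Pairwise (· < ·)) :
    (L.map fun j => iota G H ξ (ℓ j) (a j)).prod (vacuum G H ξ) =
      ((states G ℓ L).map (stateVector G ξ a)).sum := by
  induction L with
  | nil =>
    have h : IsPath G ([] : List (V × Finset (Fin k))) := List.IsChain.nil
    simp only [states, stateVector, stackVector, dif_pos h, List.map_nil, List.prod_nil,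
      List.map_cons, List.sum_cons, List.sum_nil, Finset.prod_empty, one_smul, add_zero]
    rfl
  | cons j L ih =>
    obtain ⟨hj, hL'⟩ := List.pairwise_cons.1 hL
    have hlin : ∀ l : List (BlockState k V), (∀ s ∈ l, s ∈ states G ℓ L) →
        iota G H ξ (ℓ j) (a j) ((l.map (stateVector G ξ a)).sum) =
          ((l.flatMap (step G ℓ j)).map (stateVector G ξ a)).sum := by
      intro l hl
      induction l with
      | nil => simp
      | cons s l ihl =>
        have hs := hl s List.mem_cons_self
        rw [List.flatMap_cons, List.map_append, List.sum_append,
          ← ihl fun t ht => hl t (List.mem_cons_of_mem _ ht),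
          ← iota_stateVector ξ a hG hξ hj ((mem_states hG hL').1 hs) (isPath_of_mem_states hG hs),
          List.map_cons, List.sum_cons, map_add]
    rw [List.map_cons, List.prod_cons, mul_apply_eq_comp, ih hL', states]
    exact hlin _ fun s hs => hs

omit [∀ v, CompleteSpace (H v)] in
theorem inner_vacuum_stackVector {S : List (V × Finset (Fin k))} (hS : IsPath G S) :
    ⟪vacuum G H ξ, stackVector G ξ a S⟫_ℂ = if S.isEmpty then 1 else 0 := by
  rw [stackVector, dif_pos hS, vacuum]
  match S with
  | [] =>
    refine (LinearIsometry.inner_map_map _ _ _).trans ?_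
    refine (UniformSpace.Completion.inner_coe _ _).trans ?_
    simp
  | p :: S =>
    refine inner_summand_eq_zero ?_ _ _
    intro h
    exact List.cons_ne_nil _ _ (congrArg Subtype.val h).symm

omit [∀ v, CompleteSpace (H v)] in
theorem ofFn_blockOps (π : NC ℓ G) (B : π.1.parts) : List.ofFn (blockOps a π B) =
    (B.1.sort (· ≤ ·)).map (opAt a (π.1.blockLabel ℓ B)) := by
  refine List.ext_getElem (by simp) fun i h1 h2 => ?_
  have h3 : ℓ (B.1.orderEmbOfFin rfl ⟨i, by simpa using h1⟩) = π.1.blockLabel ℓ B :=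
    π.2.isConstantOnBlocks.eq_blockLabel B (B.1.orderEmbOfFin_mem rfl _)
  rw [List.getElem_ofFn, List.getElem_map, blockOps]
  change _ = opAt a _ (B.1.orderEmbOfFin rfl ⟨i, by simpa using h1⟩)
  rw [opAt, dif_pos h3]

omit [∀ v, CompleteSpace (H v)] in
theorem blockWeight_eq_booleanCumulant (π : NC ℓ G) (B : π.1.parts) : blockWeight ξ a B.1 =
    booleanCumulant (vectorState (ξ (π.1.blockLabel ℓ B))) (blockOps a π B) := by
  have hne := π.1.nonempty_of_mem_parts B.2
  rw [blockWeight_eq ξ a hne fun x hx => π.2.isConstantOnBlocks.eq_blockLabel B hx]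
  have h := ofFn_blockOps a π B
  cases hs : (B.1.sort (· ≤ ·)) with
  | nil =>
    obtain ⟨x, hx⟩ := hne
    rw [← Finset.mem_sort (· ≤ ·), hs] at hx
    exact absurd hx List.not_mem_nil
  | cons y l =>
    rw [hs, List.map_cons] at h
    rw [booleanCumulant_vectorState _ _ h, blockVector, hs]
    rfl

end Expansion

end

end GFree

/-! ### The moment formula -/

theorem theorem3 {V : Type*} (G : Digraph V) (hG : ∀ v, ¬ G.Adj v v)
    (H : V → Type*) [∀ v, NormedAddCommGroup (H v)] [∀ v, InnerProductSpace ℂ (H v)]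
    [∀ v, CompleteSpace (H v)] (ξ : ∀ v, H v) (hξ : ∀ v, ‖ξ v‖ = 1)
    (k : ℕ) (ℓ : Fin k → V) (a : ∀ j, H (ℓ j) →L[ℂ] H (ℓ j)) :
    ⟪GFree.vacuum G H ξ,
        (List.ofFn fun j => GFree.iota G H ξ (ℓ j) (a j)).prod (GFree.vacuum G H ξ)⟫_ℂ =
      ∑ π : GFree.NC ℓ G, ∏ B : π.1.parts,
        GFree.booleanCumulant (GFree.vectorState (ξ (π.1.blockLabel ℓ B)))
          (GFree.blockOps a π B) := by
  rw [List.ofFn_eq_map, GFree.prod_iota_vacuum ξ a hG hξ (List.pairwise_lt_finRange k)]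
  have hin : ∀ l : List (GFree.ProductSpace G H ξ), ⟪GFree.vacuum G H ξ, l.sum⟫_ℂ =
      (l.map fun x => ⟪GFree.vacuum G H ξ, x⟫_ℂ).sum := fun l =>
    map_list_sum (innerSL ℂ (GFree.vacuum G H ξ)) l
  rw [hin, List.map_map]
  -- A nonempty stack gives a vector orthogonal to ξ, so only states with all blocks closed survive.
  trans ((GFree.states G ℓ (List.finRange k)).map fun s =>
    if s.2.isEmpty then ∏ B ∈ s.1, GFree.blockWeight ξ a B else 0).sum
  · congr 1
    refine List.map_congr_left fun s hs => ?_
    rw [Function.comp_apply, GFree.stateVector, inner_smul_right,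
      GFree.inner_vacuum_stackVector ξ a (GFree.isPath_of_mem_states hG hs), mul_ite, mul_one,
      mul_zero]
  · rw [GFree.sum_states_eq_sum_NC hG fun C => ∏ B ∈ C, GFree.blockWeight ξ a B]
    refine Finset.sum_congr rfl fun π _ => ?_
    rw [← Finset.prod_coe_sort]
    exact Finset.prod_congr rfl fun B _ => GFree.blockWeight_eq_booleanCumulant ξ a π B
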